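/- Let $(X,\mathsf d,\mathfrak m)$ be a metric measure space: $(X,\mathsf d)$ is a complete separable metric space and $\mathfrak m$ is a non-negative, non-zero Borel measure, finite on balls. Let $W^{1,2}(X)\subset L^2(\mathfrak m)$ be its Sobolev space, let $|Df|$ be the minimal weak upper gradient of $f\in W^{1,2}(X)$, let $L^0(T^*X)$ be the cotangent module, with the topology metrized by $\int \min(1,|\omega-\eta|)\,d\mathfrak m'$ ($\mathfrak m'$ any finite measure with the same null sets as $\mathfrak m$), and let $d:W^{1,2}(X)\to L^0(T^*X)$ be the differential. Assume that $X$ is infinitesimally Hilbertian, i.e. that $W^{1,2}(X)$ with the norm $(\|f\|_{L^2}^2+\||Df|\|_{L^2}^2)^{1/2}$ is a Hilbert space. A function $f$ is Lusin–Lipschitz if there is a Borel partition $(E_j)_{j\in\mathbb N}$ of $\mathfrak m$-almost all of $X$ such that $f|_{E_j}$ is Lipschitz for every $j$. Its differential is $df:=\sum_j\chi_{E_j}\,dg_j\in L^0(T^*X)$, where $g_j$ is a Lipschitz function on $X$ that equals $f$ on $E_j$; by locality of $d$ this does not depend on the choices (after subdividing the $E_j$ into bounded sets one can take the $g_j$ with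 bounded support, so that $g_j\in W^{1,2}(X)$). Let $\varphi:X\to[0,\infty)$ be measurable and $R>0$. For $f\in L^2(\mathfrak m)$ let $A_{\varphi,R}(f)$ be the set of all $G\in L^2(\mathfrak m)$, $G\ge 0$, for which there is an $\mathfrak m$-negligible Borel set $N$ with $$|f(x)-f(y)|\le e^{\varphi(x)+\varphi(y)}\,\bigl(G(x)+G(y)\bigr)\,\mathsf d(x,y)\qquad\text{for all }x,y\in X\setminus N\text{ with }\mathsf d(x,y)\le R.$$ Let $H_{\varphi,R}(X):=\{f\in L^2(\mathfrak m): A_{\varphi,R}(f)\ne\emptyset\}$, with the norm $\|f\|_{H_{\varphi,R}}:=\bigl(\|f\|_{L^2}^2+\inf_{G\in A_{\varphi,R}(f)}\|G\|_{L^2}^2\bigr)^{1/2}$. Every function in $H_{\varphi,R}(X)$ is Lusin–Lipschitz, so that its differential is defined. **Proposition.** Let $(f_n)\subset H_{\varphi,R}(X)$ be a sequence with $\sup_n\|f_n\|_{H_{\varphi,R}}<\infty$, and suppose that $f_n\to f$ in $L^2(\mathfrak m)$ and $df_n\to\omega$ in $L^0(T^*X)$, for some $f\in L^2(\mathfrak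 m)$ and $\omega\in L^0(T^*X)$. Then $f\in H_{\varphi,R}(X)$ and $\omega=df$. -/

import Mathlib

open MeasureTheory Filter Topology
open scoped NNReal ENNReal

namespace WeightedHajlasz

/-- A measure that is finite on balls. -/
class IsFiniteOnBalls {X : Type*} [MetricSpace X] [MeasurableSpace X] (μ : Measure X) : Prop where
  measure_ball_lt_top : ∀ (x : X) (r : ℝ), μ (Metric.ball x r) < ∞

instance IsFiniteOnBalls.isLocallyFiniteMeasure {X : Type*} [MetricSpace X] [MeasurableSpace X]
    (μ : Measure X) [IsFiniteOnBalls μ] :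
    IsLocallyFiniteMeasure μ :=
  ⟨fun x => ⟨Metric.ball x 1, Metric.ball_mem_nhds x one_pos,
    IsFiniteOnBalls.measure_ball_lt_top x 1⟩⟩

section Sobolev

variable {X : Type*} [MetricSpace X]

/-- The local Lipschitz constant `lip f x = limsup_{y → x, y ≠ x} |f y - f x| / d(y, x)`. It is
`0` at isolated points, where the punctured neighbourhood filter is trivial. -/
noncomputable def lipConst (f : X → ℝ) (x : X) : ℝ≥0∞ :=
  limsup (fun y => edist (f y) (f x) / edist y x) (𝓝[≠] x)

/-- Lipschitz functions with bounded support. -/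
def IsLipBS (f : X → ℝ) : Prop :=
  (∃ K : ℝ≥0, LipschitzWith K f) ∧ Bornology.IsBounded (Function.support f)

theorem IsLipBS.zero : IsLipBS (fun _ : X => (0 : ℝ)) :=
  ⟨⟨0, LipschitzWith.const 0⟩, by simp [Function.support]⟩

theorem IsLipBS.add {f g : X → ℝ} (hf : IsLipBS f) (hg : IsLipBS g) :
    IsLipBS (fun x => f x + g x) := by
  obtain ⟨⟨K, hK⟩, hb⟩ := hf
  obtain ⟨⟨L, hL⟩, hc⟩ := hg
  exact ⟨⟨K + L, hK.add hL⟩, (hb.union hc).subset (Function.support_add f g)⟩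

theorem IsLipBS.const_mul {f : X → ℝ} (hf : IsLipBS f) (c : ℝ) : IsLipBS (fun x => c * f x) := by
  obtain ⟨⟨K, hK⟩, hb⟩ := hf
  refine ⟨⟨‖c‖₊ * K, (lipschitzWith_smul c).comp hK⟩, hb.subset ?_⟩
  intro x hx
  simp only [Function.mem_support] at hx ⊢
  exact right_ne_zero_of_mul hx

theorem lipConst_zero (x : X) : lipConst (fun _ : X => (0 : ℝ)) x = 0 := by
  simp only [lipConst, edist_self, ENNReal.zero_div]
  by_cases h : (𝓝[≠] x).NeBot
  · exact limsup_const 0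
  · rw [not_neBot.1 h, limsup_bot]; rfl

theorem lipConst_add_le (f g : X → ℝ) (x : X) :
    lipConst (fun y => f y + g y) x ≤ lipConst f x + lipConst g x := by
  refine ENNReal.le_of_forall_pos_le_add fun ε hε hfin => ?_
  have hε' : (ε / 2 : ℝ≥0∞) ≠ 0 := by simp [hε.ne']
  have h₁ := eventually_lt_of_limsup_lt
    (ENNReal.lt_add_right (ENNReal.add_lt_top.1 hfin).1.ne hε')
  have h₂ := eventually_lt_of_limsup_lt
    (ENNReal.lt_add_right (ENNReal.add_lt_top.1 hfin).2.ne hε')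
  refine limsup_le_of_le (h := ?_)
  filter_upwards [h₁, h₂] with y hy₁ hy₂
  calc edist (f y + g y) (f x + g x) / edist y x
      ≤ edist (f y) (f x) / edist y x + edist (g y) (g x) / edist y x := by
        rw [← ENNReal.add_div]
        exact ENNReal.div_le_div_right (edist_add_add_le _ _ _ _) _
    _ ≤ (lipConst f x + ε / 2) + (lipConst g x + ε / 2) := add_le_add hy₁.le hy₂.le
    _ = lipConst f x + lipConst g x + ε := by
        rw [add_add_add_comm, ENNReal.add_halves]

theorem lipConst_const_mul_le (c : ℝ) (f : X → ℝ) (x : X) :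
    lipConst (fun y => c * f y) x ≤ ‖c‖ₑ * lipConst f x := by
  rw [lipConst, lipConst, ← ENNReal.limsup_const_mul_of_ne_top enorm_ne_top]
  refine limsup_le_limsup (Eventually.of_forall fun y => ?_)
  simp only [edist_eq_enorm_sub, ← mul_sub, enorm_mul, mul_div_assoc, le_refl]

theorem IsLipBS.lipConst_ne_top {f : X → ℝ} (hf : IsLipBS f) (x : X) : lipConst f x ≠ ∞ := by
  obtain ⟨⟨K, hK⟩, -⟩ := hf
  refine ne_top_of_le_ne_top (ENNReal.coe_ne_top (r := K)) (limsup_le_of_le (h := ?_))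
  exact Eventually.of_forall fun y => ENNReal.div_le_of_le_mul (hK y x)

variable [MeasurableSpace X]

/-- `G` is a relaxed slope of `f`: there are Lipschitz functions `v n` with bounded support
converging to `f` in `L²` and functions `H n ≥ lip (v n)` converging to `G` in `L²`. (By Mazur's
lemma one gets the same notion from weak convergence of the slopes.) -/
def IsRelaxedSlope (μ : Measure X) (f G : Lp ℝ 2 μ) : Prop :=
  ∃ (v : ℕ → X → ℝ) (u H : ℕ → Lp ℝ 2 μ),
    (∀ n, IsLipBS (v n)) ∧ (∀ n, u n =ᵐ[μ] v n) ∧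
    (∀ n, ∀ᵐ x ∂μ, (lipConst (v n) x).toReal ≤ H n x) ∧
    Tendsto u atTop (𝓝 f) ∧ Tendsto H atTop (𝓝 G)

variable {μ : Measure X}

theorem IsRelaxedSlope.nonneg {f G : Lp ℝ 2 μ} (h : IsRelaxedSlope μ f G) : 0 ≤ G := by
  obtain ⟨v, u, H, -, -, hH, -, hG⟩ := h
  refine ge_of_tendsto' hG fun n => ?_
  rw [← Lp.coeFn_nonneg]
  filter_upwards [hH n] with x hx
  exact ENNReal.toReal_nonneg.trans hx

theorem IsRelaxedSlope.zero : IsRelaxedSlope μ 0 0 :=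
  ⟨fun _ _ => 0, 0, 0, fun _ => IsLipBS.zero, fun _ => Lp.coeFn_zero ℝ 2 μ, fun _ => by
    filter_upwards [Lp.coeFn_zero ℝ 2 μ] with x hx
    rw [lipConst_zero, ENNReal.toReal_zero]
    exact hx.ge, tendsto_const_nhds, tendsto_const_nhds⟩

theorem IsRelaxedSlope.add {f₁ f₂ G₁ G₂ : Lp ℝ 2 μ} (h₁ : IsRelaxedSlope μ f₁ G₁)
    (h₂ : IsRelaxedSlope μ f₂ G₂) : IsRelaxedSlope μ (f₁ + f₂) (G₁ + G₂) := by
  obtain ⟨v, u, H, hv, hu, hH, hf, hG⟩ := h₁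
  obtain ⟨v', u', H', hv', hu', hH', hf', hG'⟩ := h₂
  refine ⟨fun n x => v n x + v' n x, fun n => u n + u' n, fun n => H n + H' n,
    fun n => (hv n).add (hv' n), fun n => ?_, fun n => ?_, hf.add hf', hG.add hG'⟩
  · filter_upwards [hu n, hu' n, Lp.coeFn_add (u n) (u' n)] with x h1 h2 h3
    rw [h3, Pi.add_apply, h1, h2]
  · filter_upwards [hH n, hH' n, Lp.coeFn_add (H n) (H' n)] with x h1 h2 h3
    rw [h3, Pi.add_apply]
    refine le_trans ?_ (add_le_add h1 h2)
    rw [← ENNReal.toReal_add ((hv n).lipConst_ne_top x) ((hv' n).lipConst_ne_top x)]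
    exact ENNReal.toReal_mono (ENNReal.add_ne_top.2
      ⟨(hv n).lipConst_ne_top x, (hv' n).lipConst_ne_top x⟩) (lipConst_add_le _ _ _)

theorem IsRelaxedSlope.smul {f G : Lp ℝ 2 μ} (h : IsRelaxedSlope μ f G) (c : ℝ) :
    IsRelaxedSlope μ (c • f) (|c| • G) := by
  obtain ⟨v, u, H, hv, hu, hH, hf, hG⟩ := h
  refine ⟨fun n x => c * v n x, fun n => c • u n, fun n => |c| • H n,
    fun n => (hv n).const_mul c, fun n => ?_, fun n => ?_, hf.const_smul c, hG.const_smul _⟩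
  · filter_upwards [hu n, Lp.coeFn_smul c (u n)] with x h1 h3
    rw [h3, Pi.smul_apply, h1, smul_eq_mul]
  · filter_upwards [hH n, Lp.coeFn_smul |c| (H n)] with x h1 h3
    rw [h3, Pi.smul_apply, smul_eq_mul]
    refine le_trans ?_ (mul_le_mul_of_nonneg_left h1 (abs_nonneg c))
    have h2 := ENNReal.toReal_mono (ENNReal.mul_ne_top enorm_ne_top ((hv n).lipConst_ne_top x))
      (lipConst_const_mul_le c (v n) x)
    rwa [ENNReal.toReal_mul, toReal_enorm, Real.norm_eq_abs] at h2

/-- The Sobolev space `W^{1,2}(X)`: the functions in `L²` that have a relaxed slope in `L²`. -/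
def sobolev (μ : Measure X) : Submodule ℝ (Lp ℝ 2 μ) where
  carrier := {f | ∃ G, IsRelaxedSlope μ f G}
  zero_mem' := ⟨0, IsRelaxedSlope.zero⟩
  add_mem' := fun ⟨_, h₁⟩ ⟨_, h₂⟩ => ⟨_, h₁.add h₂⟩
  smul_mem' := fun c _ ⟨_, h⟩ => ⟨_, h.smul c⟩

/-- The relaxed slopes of a Sobolev function have a greatest lower bound for the a.e. order. -/
theorem exists_isGLB_relaxedSlope (f : sobolev μ) :
    ∃ D : Lp ℝ 2 μ, IsGLB {G | IsRelaxedSlope μ f G} D := by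
  obtain ⟨f, G₀, hG₀⟩ := f
  set S : Set (Lp ℝ 2 μ) := {G | IsRelaxedSlope μ f G} with hS
  change ∃ D : Lp ℝ 2 μ, IsGLB S D
  let Φ : (ℕ → S) → X → ℝ≥0∞ := fun g x => ⨅ n, ‖(g n : Lp ℝ 2 μ) x‖ₑ
  have hΦm : ∀ g, Measurable (Φ g) := fun g =>
    Measurable.iInf fun n => (Lp.stronglyMeasurable (g n : Lp ℝ 2 μ)).measurable.enorm
  let I : (ℕ → S) → ℝ≥0∞ := fun g => ∫⁻ x, Φ g x ^ 2 ∂μ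
  have hfin : ∀ g, I g ≠ ∞ := by
    intro g
    have h1 : I g ≤ ∫⁻ x, ‖(g 0 : Lp ℝ 2 μ) x‖ₑ ^ 2 ∂μ :=
      lintegral_mono fun x => pow_le_pow_left' (iInf_le _ 0) 2
    have h2 := (Lp.memLp (g 0 : Lp ℝ 2 μ)).eLpNorm_lt_top
    rw [eLpNorm_lt_top_iff_lintegral_rpow_enorm_lt_top two_ne_zero ENNReal.ofNat_ne_top] at h2
    simp only [ENNReal.toReal_ofNat, ENNReal.rpow_ofNat] at h2
    exact (h1.trans_lt h2).ne
  have : Nonempty (ℕ → S) := ⟨fun _ => ⟨G₀, hG₀⟩⟩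
  obtain ⟨c, -, hc, hcmem⟩ := exists_seq_tendsto_sInf (Set.range_nonempty I) (OrderBot.bddBelow _)
  choose g hg using hcmem
  let h : ℕ → S := fun n => g n.unpair.1 n.unpair.2
  have hle : ∀ k x, Φ h x ≤ Φ (g k) x := fun k x =>
    le_iInf fun m => (iInf_le _ (Nat.pair k m)).trans (by simp [h])
  have hmin : ∀ g', I h ≤ I g' := by
    intro g'
    refine le_trans (ge_of_tendsto' hc fun k => ?_) (sInf_le ⟨g', rfl⟩)
    rw [← hg k]
    exact lintegral_mono fun x => pow_le_pow_left' (hle k x) 2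
  have hlow : ∀ G : S, ∀ᵐ x ∂μ, Φ h x ≤ ‖(G : Lp ℝ 2 μ) x‖ₑ := by
    intro G
    let h' : ℕ → S := fun n => n.casesOn G h
    have hh' : ∀ x, Φ h' x ≤ Φ h x := fun x => le_iInf fun m => iInf_le _ (m + 1)
    have heq := ae_eq_of_ae_le_of_lintegral_le (μ := μ) (f := fun x => Φ h' x ^ 2)
      (g := fun x => Φ h x ^ 2)
      (Eventually.of_forall fun x => pow_le_pow_left' (hh' x) 2) (hfin h')
      ((hΦm h).pow_const 2).aemeasurable (hmin h')
    filter_upwards [heq] with x hx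
    have : Φ h' x = Φ h x := (ENNReal.pow_right_strictMono two_ne_zero).injective hx
    rw [← this]
    exact iInf_le _ 0
  have hD : MemLp (fun x => (Φ h x).toReal) 2 μ := by
    refine (Lp.memLp (h 0 : Lp ℝ 2 μ)).of_le (hΦm h).ennreal_toReal.aestronglyMeasurable ?_
    refine Eventually.of_forall fun x => ?_
    rw [Real.norm_of_nonneg ENNReal.toReal_nonneg, ← toReal_enorm]
    exact ENNReal.toReal_mono enorm_ne_top (iInf_le _ 0)
  have hnn : ∀ G : S, ∀ᵐ x ∂μ, (‖(G : Lp ℝ 2 μ) x‖ₑ).toReal = (G : Lp ℝ 2 μ) x := by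
    intro G
    have := (Lp.coeFn_nonneg _).2 G.2.nonneg
    filter_upwards [this] with x hx
    rw [toReal_enorm, Real.norm_of_nonneg hx]
  refine ⟨hD.toLp _, ?_, ?_⟩
  · intro G hG
    rw [← Lp.coeFn_le]
    filter_upwards [hD.coeFn_toLp, hlow ⟨G, hG⟩, hnn ⟨G, hG⟩] with x h1 h2 h3
    rw [h1, ← h3]
    exact ENNReal.toReal_mono enorm_ne_top h2
  · intro L hL
    rw [← Lp.coeFn_le]
    have hall : ∀ᵐ x ∂μ, ∀ n, L x ≤ (h n : Lp ℝ 2 μ) x :=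
      ae_all_iff.2 fun n => (Lp.coeFn_le _ _).2 (hL (h n).2)
    have hall' := ae_all_iff.2 fun n => hnn (h n)
    filter_upwards [hD.coeFn_toLp, hall, hall'] with x h1 h2 h3
    rw [h1, ENNReal.toReal_iInf fun _ => enorm_ne_top]
    exact le_ciInf fun n => by rw [h3 n]; exact h2 n

/-- The minimal relaxed slope `|Df|` (minimal weak upper gradient): the greatest lower
bound, for the a.e. order, of the relaxed slopes of `f` (it is itself a relaxed slope of `f`, the
one of least `L²` norm). -/
noncomputable def minSlope (f : sobolev μ) : Lp ℝ 2 μ := (exists_isGLB_relaxedSlope f).choose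

theorem isGLB_minSlope (f : sobolev μ) : IsGLB {G | IsRelaxedSlope μ f G} (minSlope f) :=
  (exists_isGLB_relaxedSlope f).choose_spec

theorem minSlope_nonneg (f : sobolev μ) : 0 ≤ minSlope f :=
  (isGLB_minSlope f).2 fun _ hG => hG.nonneg

theorem minSlope_zero : minSlope (0 : sobolev μ) = 0 :=
  le_antisymm ((isGLB_minSlope 0).1 IsRelaxedSlope.zero) (minSlope_nonneg 0)

theorem minSlope_add_le (f g : sobolev μ) : minSlope (f + g) ≤ minSlope f + minSlope g := by
  rw [← sub_le_iff_le_add]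
  refine (isGLB_minSlope f).2 fun F hF => ?_
  rw [sub_le_comm]
  refine (isGLB_minSlope g).2 fun G hG => ?_
  rw [sub_le_iff_le_add']
  exact (isGLB_minSlope (f + g)).1 (hF.add hG)

theorem minSlope_neg_le (f : sobolev μ) : minSlope (-f) ≤ minSlope f :=
  (isGLB_minSlope f).2 fun G hG => (isGLB_minSlope (-f)).1 <| by
    simpa using IsRelaxedSlope.smul hG (-1)

theorem minSlope_neg (f : sobolev μ) : minSlope (-f) = minSlope f :=
  le_antisymm (minSlope_neg_le f) (by simpa using minSlope_neg_le (-f))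

/-- `X` is infinitesimally Hilbertian: `W^{1,2}(X)` with the norm
`‖f‖² = ‖f‖_{L²}² + ‖|Df|‖_{L²}²` satisfies the parallelogram identity (the `L²` part always
does). -/
def InfinitesimallyHilbertian (μ : Measure X) : Prop :=
  ∀ f g : sobolev μ, (‖(f + g : sobolev μ)‖ ^ 2 + ‖minSlope (f + g)‖ ^ 2) +
      (‖(f - g : sobolev μ)‖ ^ 2 + ‖minSlope (f - g)‖ ^ 2) =
    2 * (‖f‖ ^ 2 + ‖minSlope f‖ ^ 2) + 2 * (‖g‖ ^ 2 + ‖minSlope g‖ ^ 2)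

end Sobolev
section Cotangent

variable {X : Type*} [MetricSpace X] [MeasurableSpace X]

/-- Simple forms `∑ᵢ χ_{Eᵢ} dfᵢ`, with `(Eᵢ)` a finite measurable partition of `X` and
`fᵢ ∈ W^{1,2}(X)`, recorded as the simple function equal to `fᵢ` on `Eᵢ`. -/
def SimpleForm (μ : Measure X) : Type _ := SimpleFunc X (sobolev μ)

noncomputable instance SimpleForm.addCommGroup (μ : Measure X) : AddCommGroup (SimpleForm μ) :=
  inferInstanceAs (AddCommGroup (SimpleFunc X (sobolev μ)))

/-- The simple form `χ_E df`, for a measurable set `E` and `f ∈ W^{1,2}(X)`. -/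
noncomputable def SimpleForm.single {μ : Measure X} (E : Set X) (f : sobolev μ) : SimpleForm μ :=
  (SimpleFunc.const X f).restrict E

/-- The pointwise norm of a simple form: `|∑ᵢ χ_{Eᵢ} dfᵢ| = |Dfᵢ|` on `Eᵢ`. -/
noncomputable def SimpleForm.pointwiseNorm {μ : Measure X} (s : SimpleForm μ) (x : X) : ℝ :=
  minSlope (SimpleFunc.toFun s x) x

theorem SimpleForm.ae_of_forall {μ : Measure X} {p : sobolev μ → X → Prop} (s : SimpleForm μ)
    (h : ∀ f, ∀ᵐ x ∂μ, p f x) : ∀ᵐ x ∂μ, p (SimpleFunc.toFun s x) x := by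
  have := (ae_ball_iff (SimpleFunc.finite_range s).countable).2 fun f _ => h f
  filter_upwards [this] with x hx
  exact hx _ ⟨x, rfl⟩

theorem SimpleForm.measurable_pointwiseNorm {μ : Measure X} (s : SimpleForm μ) :
    Measurable s.pointwiseNorm :=
  SimpleFunc.measurable_bind s (fun f x => minSlope f x) fun f =>
    (Lp.stronglyMeasurable (minSlope f)).measurable

theorem SimpleForm.pointwiseNorm_nonneg {μ : Measure X} (s : SimpleForm μ) :
    ∀ᵐ x ∂μ, 0 ≤ s.pointwiseNorm x :=
  s.ae_of_forall (p := fun f x => 0 ≤ minSlope f x) fun f =>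
    (Lp.coeFn_nonneg _).2 (minSlope_nonneg f)

theorem SimpleForm.pointwiseNorm_zero {μ : Measure X} :
    ∀ᵐ x ∂μ, (0 : SimpleForm μ).pointwiseNorm x = 0 := by
  change ∀ᵐ x ∂μ, minSlope (0 : sobolev μ) x = 0
  rw [minSlope_zero]
  exact Lp.coeFn_zero ℝ 2 μ

theorem SimpleForm.pointwiseNorm_neg {μ : Measure X} (s : SimpleForm μ) :
    (-s).pointwiseNorm = s.pointwiseNorm := by
  funext x
  change minSlope (-(SimpleFunc.toFun s x)) x = minSlope (SimpleFunc.toFun s x) x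
  rw [minSlope_neg]

theorem SimpleForm.pointwiseNorm_add_le {μ : Measure X} (s t : SimpleForm μ) :
    ∀ᵐ x ∂μ, (s + t).pointwiseNorm x ≤ s.pointwiseNorm x + t.pointwiseNorm x := by
  have h := (ae_ball_iff (SimpleFunc.finite_range s).countable).2 fun f _ =>
    (ae_ball_iff (SimpleFunc.finite_range t).countable (p := fun x g _ =>
      minSlope (f + g) x ≤ minSlope f x + minSlope g x)).2 fun g _ => by
        have := (Lp.coeFn_le _ _).2 (minSlope_add_le f g)
        filter_upwards [this, Lp.coeFn_add (minSlope f) (minSlope g)] with x h1 h2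
        rw [h2] at h1
        exact h1
  filter_upwards [h] with x hx
  exact hx _ ⟨x, rfl⟩ _ ⟨x, rfl⟩

theorem SimpleForm.integrable_min {μ : Measure X} [SFinite μ] (s : SimpleForm μ) :
    Integrable (fun x => min 1 (s.pointwiseNorm x)) μ.toFinite := by
  refine Integrable.of_bound (C := 1)
    (measurable_const.min s.measurable_pointwiseNorm).aestronglyMeasurable ?_
  have h := s.pointwiseNorm_nonneg
  rw [← ae_toFinite] at h
  filter_upwards [h] with x hx
  rw [Real.norm_of_nonneg (le_min zero_le_one hx)]
  exact min_le_left _ _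

/-- Simple forms carry the translation-invariant distance `∫ min(1, |s - t|) dm'` of `L⁰`, where
`m'` is a finite measure with the same null sets as the reference measure `m`. -/
noncomputable instance SimpleForm.seminormedAddCommGroup (μ : Measure X) [SFinite μ] :
    SeminormedAddCommGroup (SimpleForm μ) :=
  AddGroupSeminorm.toSeminormedAddCommGroup
    { toFun := fun s => ∫ x, min 1 (s.pointwiseNorm x) ∂μ.toFinite
      map_zero' := by
        refine integral_eq_zero_of_ae ?_
        have h := SimpleForm.pointwiseNorm_zero (μ := μ)
        rw [← ae_toFinite] at h
        filter_upwards [h] with x hx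
        simp [hx]
      add_le' := fun s t => by
        rw [← integral_add s.integrable_min t.integrable_min]
        refine integral_mono_ae (s + t).integrable_min
          (s.integrable_min.add t.integrable_min) ?_
        have h1 := s.pointwiseNorm_nonneg
        have h2 := t.pointwiseNorm_nonneg
        have h3 := s.pointwiseNorm_add_le t
        rw [← ae_toFinite] at h1 h2 h3
        filter_upwards [h1, h2, h3] with x a b c
        rcases le_total 1 (s.pointwiseNorm x) with h | h
        · exact (min_le_left _ _).trans (by rw [min_eq_left h]; simp [b])
        rcases le_total 1 (t.pointwiseNorm x) with h' | h'
        · exact (min_le_left _ _).trans (by rw [min_eq_left h']; simp [a])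
        rw [min_eq_right h, min_eq_right h']
        exact (min_le_right _ _).trans c
      neg' := fun s => by simp only [SimpleForm.pointwiseNorm_neg] }

/-- The cotangent module `L⁰(T*X)`: the completion of the simple forms for the `L⁰` distance
(forms at distance zero, i.e. with `|s - t| = 0` a.e., being identified). -/
abbrev CotangentL0 (μ : Measure X) [SFinite μ] : Type _ := UniformSpace.Completion (SimpleForm μ)

/-- The element `χ_E df` of `L⁰(T*X)`. -/
noncomputable def chiD (μ : Measure X) [SFinite μ] (E : Set X) (f : sobolev μ) : CotangentL0 μ :=
  ((SimpleForm.single E f : SimpleForm μ) : UniformSpace.Completion (SimpleForm μ))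

/-- `ω = ∑ⱼ χ_{Eⱼ} dgⱼ` in `L⁰(T*X)`, where `(Eⱼ)` is a Borel partition of almost all of `X` and
`gⱼ` is a Lipschitz function equal to `f` on `Eⱼ`. Subdividing the `Eⱼ` into bounded sets and
cutting off the `gⱼ`, one can take the `gⱼ` with bounded support, so that `gⱼ ∈ W^{1,2}(X)`. In
particular `f` is Lusin-Lipschitz. -/
def HasDifferential (μ : Measure X) [SFinite μ] (f : X → ℝ) (ω : CotangentL0 μ) : Prop :=
  ∃ (E : ℕ → Set X) (g : ℕ → sobolev μ) (v : ℕ → X → ℝ),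
    (∀ j, MeasurableSet (E j)) ∧ Pairwise (Function.onFun Disjoint E) ∧ μ (⋃ j, E j)ᶜ = 0 ∧
    (∀ j, IsLipBS (v j)) ∧ (∀ j, (g j : Lp ℝ 2 μ) =ᵐ[μ] v j) ∧
    (∀ j, ∀ᵐ x ∂μ, x ∈ E j → f x = v j x) ∧
    HasSum (fun j => chiD μ (E j) (g j)) ω

open Classical in
/-- The differential of a Lusin-Lipschitz function (which does not depend on the choices of the
sets `Eⱼ` and the functions `gⱼ`); `0` for other functions. -/
noncomputable def differential (μ : Measure X) [SFinite μ] (f : X → ℝ) : CotangentL0 μ :=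
  if h : ∃ ω, HasDifferential μ f ω then h.choose else 0

end Cotangent

section Hajlasz

variable {X : Type*} [MetricSpace X] [MeasurableSpace X] {μ : Measure X}

/-- The set `A_{φ,R}(f)` of functions admissible for `f`. -/
def admissible (φ : X →ₘ[μ] ℝ) (R : ℝ) (f : Lp ℝ 2 μ) : Set (Lp ℝ 2 μ) :=
  {G | 0 ≤ G ∧ ∃ N : Set X, MeasurableSet N ∧ μ N = 0 ∧ ∀ x ∉ N, ∀ y ∉ N, dist x y ≤ R →
    |f x - f y| ≤ Real.exp (φ x + φ y) * (G x + G y) * dist x y}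

/-- The weighted Hajłasz-Sobolev space `H_{φ,R}(X)`. -/
def hajlaszSobolev (φ : X →ₘ[μ] ℝ) (R : ℝ) : Set (Lp ℝ 2 μ) :=
  {f | (admissible φ R f).Nonempty}

/-- The norm `‖f‖_{H_{φ,R}} = (‖f‖² + inf_{G ∈ A_{φ,R}(f)} ‖G‖²)^{1/2}` of `f ∈ H_{φ,R}(X)`. -/
noncomputable def hajlaszNorm (φ : X →ₘ[μ] ℝ) (R : ℝ) (f : Lp ℝ 2 μ) : ℝ :=
  Real.sqrt (‖f‖ ^ 2 + sInf ((fun G : Lp ℝ 2 μ => ‖G‖ ^ 2) '' admissible φ R f))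

end Hajlasz

end WeightedHajlasz

open WeightedHajlasz

/-! The proof is two rounds of Mazur's argument, each carried out by hand from a parallelogram
identity.

Round one gives `f₀ ∈ hajlaszSobolev φ R`. Choose `Gₙ` admissible for `fₙ` with bounded `L²` norms.
Near-minimisers of the norm over convex combinations of tails form a Cauchy sequence
(`exists_tailWeights_cauchy`), so suitable combinations of the `Gₙ` converge in `L²`. The same
weights are applied to `fₙ` and `dfₙ`. The space `L⁰(T*X)` is not locally convex, so a subsequence
with summable distances to the limit is taken beforehand; convex combinations of its tails then keep
the limit (`tendsto_linearCombination_of_summable`). After further subsequences `Fₙ → f₀` and `Gₙ →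
G₀` almost everywhere, and the pointwise inequality passes to the limit.

Round two identifies `ω`. Sequences that converge almost everywhere are pointwise bounded, so almost
all of `X` splits into sets of diameter at most `R` on which the `Fₙ` are uniformly bounded and
uniformly Lipschitz (`exists_lipschitz_partition`). On such a set `A` they extend to Lipschitz
functions with bounded support, bounded in `W^{1,2}` (`exists_sobolev_extension`). Infinitesimal
Hilbertianity is the parallelogram identity for the Sobolev norm, so convex combinations of the
extensions converge strongly in `W^{1,2}` to some `g`. Then `g = f₀` on `A`, and by locality and
continuity of the differential `χ_A ω = χ_A dg` (`exists_res_eq_chiD`). Hence `ω` is locally the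
differential of `f₀`, and local differentials are unique.

The calculus behind this rests on two facts about relaxed slopes: the minimal one is attained
(`isRelaxedSlope_minSlope`), because slopes can be glued along Borel sets, and it vanishes almost
everywhere on `{f = 0}` (`minSlope_eq_zero_of_eq_zero`), by truncation near zero. They yield
completeness of `W^{1,2}` and locality of the differential. -/

namespace WeightedHajlasz

/-! ### Bounds for cut-off functions with values in [0, 1]. -/

section UnitBounds

variable {X : Type*}

theorem abs_one_sub_le_one {h : X → ℝ} (h0 : ∀ x, 0 ≤ h x) (h1 : ∀ x, h x ≤ 1) (x : X) :
    |1 - h x| ≤ 1 := by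
  rw [abs_le]
  constructor <;> linarith [h0 x, h1 x]

theorem abs_le_one_of_nonneg {h : X → ℝ} (h0 : ∀ x, 0 ≤ h x) (h1 : ∀ x, h x ≤ 1) (x : X) :
    |h x| ≤ 1 := by
  rw [abs_of_nonneg (h0 x)]
  exact h1 x

theorem indicator_one_nonneg (B : Set X) (x : X) : (0 : ℝ) ≤ B.indicator 1 x :=
  Set.indicator_nonneg (fun _ _ => zero_le_one) x

theorem indicator_one_le_one (B : Set X) (x : X) : B.indicator (1 : X → ℝ) x ≤ 1 :=
  Set.indicator_le' (fun _ _ => le_rfl) (fun _ _ => zero_le_one) x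

end UnitBounds

/-! ### Multiplication and gluing in `L²`. -/

section MulLp

variable {X : Type*} [MeasurableSpace X] {μ : Measure X}

theorem memLp_bdd_mul {h : X → ℝ} (hm : Measurable h) (hb : ∀ x, |h x| ≤ 1) (u : Lp ℝ 2 μ) :
    MemLp (fun x => h x * u x) 2 μ := by
  refine (Lp.memLp u).of_le (hm.aestronglyMeasurable.mul (Lp.aestronglyMeasurable u)) ?_
  refine Eventually.of_forall fun x => ?_
  rw [norm_mul]
  exact mul_le_of_le_one_left (norm_nonneg _) (hb x)

/-- Multiplication of square integrable functions by a measurable function bounded by `1`. -/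
noncomputable def mulLp (μ : Measure X) (h : X → ℝ) (hm : Measurable h) (hb : ∀ x, |h x| ≤ 1) :
    Lp ℝ 2 μ →L[ℝ] Lp ℝ 2 μ :=
  LinearMap.mkContinuous
    { toFun := fun u => (memLp_bdd_mul hm hb u).toLp _
      map_add' := fun u v => by
        apply Lp.ext
        filter_upwards [(memLp_bdd_mul hm hb (u + v)).coeFn_toLp, (memLp_bdd_mul hm hb u).coeFn_toLp,
          (memLp_bdd_mul hm hb v).coeFn_toLp, Lp.coeFn_add u v,
          Lp.coeFn_add ((memLp_bdd_mul hm hb u).toLp _) ((memLp_bdd_mul hm hb v).toLp _)]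
          with x h1 h2 h3 h4 h5
        rw [h1, h5, Pi.add_apply, h2, h3, h4, Pi.add_apply, mul_add]
      map_smul' := fun c u => by
        apply Lp.ext
        filter_upwards [(memLp_bdd_mul hm hb (c • u)).coeFn_toLp,
          (memLp_bdd_mul hm hb u).coeFn_toLp, Lp.coeFn_smul c u,
          Lp.coeFn_smul c ((memLp_bdd_mul hm hb u).toLp _)] with x h1 h2 h3 h4
        simp only [RingHom.id_apply]
        rw [h1, h4, Pi.smul_apply, h2, h3, Pi.smul_apply, smul_eq_mul, smul_eq_mul]
        ring } 1 (fun u => by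
      rw [one_mul]
      refine Lp.norm_le_norm_of_ae_le ?_
      filter_upwards [(memLp_bdd_mul hm hb u).coeFn_toLp] with x hx
      change ‖((memLp_bdd_mul hm hb u).toLp _ : Lp ℝ 2 μ) x‖ ≤ _
      rw [hx, norm_mul]
      exact mul_le_of_le_one_left (norm_nonneg _) (hb x))

theorem coeFn_mulLp (h : X → ℝ) (hm : Measurable h) (hb : ∀ x, |h x| ≤ 1) (u : Lp ℝ 2 μ) :
    mulLp μ h hm hb u =ᵐ[μ] fun x => h x * u x :=
  (memLp_bdd_mul hm hb u).coeFn_toLp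

theorem norm_mulLp_le (h : X → ℝ) (hm : Measurable h) (hb : ∀ x, |h x| ≤ 1) (u : Lp ℝ 2 μ) :
    ‖mulLp μ h hm hb u‖ ≤ ‖u‖ := by
  refine Lp.norm_le_norm_of_ae_le ?_
  filter_upwards [coeFn_mulLp h hm hb u] with x hx
  rw [hx, norm_mul]
  exact mul_le_of_le_one_left (norm_nonneg _) (hb x)

theorem tendsto_Lp_two_of_dominated {u : ℕ → Lp ℝ 2 μ} {u₀ b : Lp ℝ 2 μ}
    (hb : ∀ n, ∀ᵐ x ∂μ, |u n x - u₀ x| ≤ |b x|)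
    (hl : ∀ᵐ x ∂μ, Tendsto (fun n => u n x) atTop (𝓝 (u₀ x))) :
    Tendsto u atTop (𝓝 u₀) := by
  rw [Lp.tendsto_Lp_iff_tendsto_eLpNorm']
  have key : Tendsto (fun n => ∫⁻ x, ‖u n x - u₀ x‖ₑ ^ (2 : ℝ) ∂μ) atTop (𝓝 0) := by
    have hbm := (Lp.memLp b).eLpNorm_lt_top
    rw [eLpNorm_lt_top_iff_lintegral_rpow_enorm_lt_top two_ne_zero ENNReal.ofNat_ne_top] at hbm
    simp only [ENNReal.toReal_ofNat] at hbm
    have := tendsto_lintegral_of_dominated_convergence (μ := μ)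
      (F := fun n x => ‖u n x - u₀ x‖ₑ ^ (2 : ℝ)) (f := fun _ => 0)
      (fun x => ‖b x‖ₑ ^ (2 : ℝ))
      (fun n => (((Lp.stronglyMeasurable (u n)).sub
        (Lp.stronglyMeasurable u₀)).measurable.enorm.pow_const _)) ?_ hbm.ne ?_
    · simpa using this
    · intro n
      filter_upwards [hb n] with x hx
      refine ENNReal.rpow_le_rpow ?_ two_pos.le
      rw [enorm_le_iff_norm_le]
      exact hx
    · filter_upwards [hl] with x hx
      have h1 : Tendsto (fun n => u n x - u₀ x) atTop (𝓝 0) := by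
        simpa using hx.sub_const (u₀ x)
      have h2 := (ENNReal.continuous_rpow_const (y := 2)).tendsto 0 |>.comp
        ((continuous_enorm.tendsto (0 : ℝ)).comp h1 |>.trans (by simp))
      simpa [Function.comp_def] using h2
  have := (ENNReal.continuous_rpow_const (y := 1 / 2)).tendsto 0 |>.comp key
  simp only [one_div, ENNReal.zero_rpow_of_pos (by norm_num : (0 : ℝ) < 2⁻¹)] at this
  refine this.congr fun n => ?_
  rw [eLpNorm_eq_lintegral_rpow_enorm_toReal two_ne_zero ENNReal.ofNat_ne_top]
  simp

theorem tendsto_mulLp {h : ℕ → X → ℝ} {h₀ : X → ℝ} (hm : ∀ n, Measurable (h n))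
    (hb : ∀ n x, |h n x| ≤ 1) (hm₀ : Measurable h₀) (hb₀ : ∀ x, |h₀ x| ≤ 1) (u : Lp ℝ 2 μ)
    (hl : ∀ᵐ x ∂μ, Tendsto (fun n => h n x) atTop (𝓝 (h₀ x))) :
    Tendsto (fun n => mulLp μ (h n) (hm n) (hb n) u) atTop (𝓝 (mulLp μ h₀ hm₀ hb₀ u)) := by
  refine tendsto_Lp_two_of_dominated (b := (2 : ℝ) • u) (fun n => ?_) ?_
  · filter_upwards [coeFn_mulLp (h n) (hm n) (hb n) u, coeFn_mulLp h₀ hm₀ hb₀ u,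
      Lp.coeFn_smul (2 : ℝ) u] with x h1 h2 h3
    rw [h1, h2, h3, ← sub_mul, Pi.smul_apply, smul_eq_mul, abs_mul, abs_mul]
    refine mul_le_mul_of_nonneg_right ?_ (abs_nonneg _)
    rw [abs_two]
    exact (abs_sub _ _).trans (by linarith [hb n x, hb₀ x])
  · have hall := ae_all_iff.2 fun n => coeFn_mulLp (h n) (hm n) (hb n) u
    filter_upwards [hall, coeFn_mulLp h₀ hm₀ hb₀ u, hl] with x h1 h2 h3
    rw [h2]
    simp only [h1]
    exact h3.mul_const _

/-- The function `h F + (1 - h) G`, for `0 ≤ h ≤ 1`. -/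
noncomputable def glue (μ : Measure X) (h : X → ℝ) (hm : Measurable h) (h0 : ∀ x, 0 ≤ h x)
    (h1 : ∀ x, h x ≤ 1) (F G : Lp ℝ 2 μ) : Lp ℝ 2 μ :=
  mulLp μ h hm (abs_le_one_of_nonneg h0 h1) F +
    mulLp μ (fun x => 1 - h x) (measurable_const.sub hm) (abs_one_sub_le_one h0 h1) G

theorem coeFn_glue (h : X → ℝ) (hm : Measurable h) (h0 : ∀ x, 0 ≤ h x)
    (h1 : ∀ x, h x ≤ 1) (F G : Lp ℝ 2 μ) :
    glue μ h hm h0 h1 F G =ᵐ[μ] fun x => h x * F x + (1 - h x) * G x := by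
  filter_upwards [Lp.coeFn_add (mulLp μ h hm (abs_le_one_of_nonneg h0 h1) F)
      (mulLp μ (fun x => 1 - h x) (measurable_const.sub hm) (abs_one_sub_le_one h0 h1) G),
    coeFn_mulLp h hm (abs_le_one_of_nonneg h0 h1) F,
    coeFn_mulLp (fun x => 1 - h x) (measurable_const.sub hm) (abs_one_sub_le_one h0 h1) G]
    with x a b c
  rw [glue, a, Pi.add_apply, b, c]

theorem glue_self (h : X → ℝ) (hm : Measurable h) (h0 : ∀ x, 0 ≤ h x)
    (h1 : ∀ x, h x ≤ 1) (F : Lp ℝ 2 μ) : glue μ h hm h0 h1 F F = F := by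
  apply Lp.ext
  filter_upwards [coeFn_glue h hm h0 h1 F F] with x hx
  rw [hx]
  ring

theorem tendsto_glue {h : ℕ → X → ℝ} {h' : X → ℝ} (hm : ∀ n, Measurable (h n))
    (h0 : ∀ n x, 0 ≤ h n x) (h1 : ∀ n x, h n x ≤ 1) (hm' : Measurable h') (h0' : ∀ x, 0 ≤ h' x)
    (h1' : ∀ x, h' x ≤ 1) (F G : Lp ℝ 2 μ) (hl : ∀ x, Tendsto (fun n => h n x) atTop (𝓝 (h' x))) :
    Tendsto (fun n => glue μ (h n) (hm n) (h0 n) (h1 n) F G) atTop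
      (𝓝 (glue μ h' hm' h0' h1' F G)) :=
  (tendsto_mulLp _ _ _ _ _ (Eventually.of_forall hl)).add
    (tendsto_mulLp _ _ _ _ _ (Eventually.of_forall fun x => (hl x).const_sub 1))

end MulLp

/-! ### Local Lipschitz constants of products and truncations. -/

section Slope

variable {X : Type*} [MetricSpace X]

/-- Replaces the limsup of difference quotients by an inequality without division, which is trivial
at `y = x` and so also covers isolated points. -/
theorem lipConst_le_ofReal_iff {v : X → ℝ} {x : X} {a : ℝ} (ha : 0 ≤ a) :
    lipConst v x ≤ ENNReal.ofReal a ↔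
      ∀ ε > 0, ∀ᶠ y in 𝓝 x, |v y - v x| ≤ (a + ε) * dist y x := by
  have hdiv : ∀ y ≠ x, ∀ b : ℝ, 0 ≤ b →
      (edist (v y) (v x) / edist y x ≤ ENNReal.ofReal b ↔ |v y - v x| ≤ b * dist y x) := by
    intro y hy b hb
    rw [ENNReal.div_le_iff (by simpa using hy) (edist_ne_top _ _), edist_dist, edist_dist,
      ← ENNReal.ofReal_mul hb, ENNReal.ofReal_le_ofReal_iff (by positivity), Real.dist_eq]
  constructor
  · intro h ε hε
    have h1 : lipConst v x < ENNReal.ofReal (a + ε) :=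
      h.trans_lt ((ENNReal.ofReal_lt_ofReal_iff (by linarith)).2 (by linarith))
    have h2 := eventually_lt_of_limsup_lt h1
    rw [eventually_nhdsWithin_iff] at h2
    filter_upwards [h2] with y hy
    by_cases hyx : y = x
    · simp [hyx]
    · exact (hdiv y hyx _ (by linarith)).1 (hy hyx).le
  · intro h
    refine ENNReal.le_of_forall_pos_le_add fun ε hε _ => ?_
    have h1 := h ε hε
    rw [lipConst]
    refine limsup_le_of_le (h := ?_)
    rw [eventually_nhdsWithin_iff]
    filter_upwards [h1] with y hy hyx
    have := (hdiv y hyx (a + ε) (by positivity)).2 hy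
    rwa [ENNReal.ofReal_add ha ε.coe_nonneg, ENNReal.ofReal_coe_nnreal] at this

theorem IsLipBS.toReal_lipConst_le_iff {v : X → ℝ} (hv : IsLipBS v) {x : X} {a : ℝ} (ha : 0 ≤ a) :
    (lipConst v x).toReal ≤ a ↔ ∀ ε > 0, ∀ᶠ y in 𝓝 x, |v y - v x| ≤ (a + ε) * dist y x := by
  rw [← lipConst_le_ofReal_iff ha, ENNReal.le_ofReal_iff_toReal_le (hv.lipConst_ne_top x) ha]

theorem IsLipBS.continuous {v : X → ℝ} (hv : IsLipBS v) : Continuous v :=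
  hv.1.choose_spec.continuous

theorem IsLipBS.exists_bound {v : X → ℝ} (hv : IsLipBS v) : ∃ C : ℝ, 0 ≤ C ∧ ∀ x, |v x| ≤ C := by
  obtain ⟨⟨K, hK⟩, hb⟩ := hv
  obtain ⟨C, hC⟩ := (hK.isBounded_image hb).exists_norm_le
  refine ⟨max C 0, le_max_right _ _, fun x => ?_⟩
  by_cases hx : v x = 0
  · simp [hx]
  · exact (hC _ ⟨x, hx, rfl⟩).trans (le_max_left _ _)

theorem IsLipBS.mul_left {χ v : X → ℝ} {K : ℝ≥0} (hχ : LipschitzWith K χ)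
    (hb : ∀ x, |χ x| ≤ 1) (hv : IsLipBS v) : IsLipBS (fun x => χ x * v x) := by
  obtain ⟨C, hC0, hC⟩ := hv.exists_bound
  obtain ⟨⟨L, hL⟩, hs⟩ := hv
  refine ⟨⟨L + K * C.toNNReal, LipschitzWith.of_dist_le_mul fun x y => ?_⟩, hs.subset ?_⟩
  · have h1 := hL.dist_le_mul x y
    have h2 := hχ.dist_le_mul x y
    rw [Real.dist_eq] at h1 h2 ⊢
    have h3 : χ x * v x - χ y * v y = χ x * (v x - v y) + (χ x - χ y) * v y := by ring
    rw [h3]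
    refine (abs_add_le _ _).trans ?_
    rw [abs_mul, abs_mul]
    push_cast
    rw [Real.coe_toNNReal C hC0]
    have h4 := mul_le_mul (hb x) h1 (abs_nonneg _) zero_le_one
    have h5 := mul_le_mul h2 (hC y) (abs_nonneg _) (by positivity)
    linarith
  · intro x hx
    simp only [Function.mem_support] at hx ⊢
    exact right_ne_zero_of_mul hx

/-- Leibniz rule: the only term besides the convex combination of the slopes comes from
differentiating `χ` and carries the factor `v - w`. It disappears in the limit when `v` and `w`
approximate the same function. -/
theorem toReal_lipConst_glue_le {χ v w : X → ℝ} {K : ℝ≥0} (hχ : LipschitzWith K χ)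
    (hχ0 : ∀ x, 0 ≤ χ x) (hχ1 : ∀ x, χ x ≤ 1) (hv : IsLipBS v) (hw : IsLipBS w)
    (hg : IsLipBS fun x => χ x * v x + (1 - χ x) * w x) {x : X} {a b : ℝ}
    (ha : (lipConst v x).toReal ≤ a) (hb : (lipConst w x).toReal ≤ b) :
    (lipConst (fun x => χ x * v x + (1 - χ x) * w x) x).toReal ≤
      χ x * a + (1 - χ x) * b + K * |v x - w x| := by
  have ha0 : 0 ≤ a := ENNReal.toReal_nonneg.trans ha
  have hb0 : 0 ≤ b := ENNReal.toReal_nonneg.trans hb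
  have hx0 := hχ0 x
  have hx1 : 0 ≤ 1 - χ x := by linarith [hχ1 x]
  rw [hg.toReal_lipConst_le_iff (by positivity)]
  intro ε hε
  rw [hv.toReal_lipConst_le_iff ha0] at ha
  rw [hw.toReal_lipConst_le_iff hb0] at hb
  -- Half of `ε` is spent on the slopes of `v` and `w`, whose weights sum to one; multiplied by `K`,
  -- this margin costs at most the other half.
  have hδ : 0 < ε / (2 * (K + 1)) := by positivity
  have hcont : ∀ᶠ y in 𝓝 x, |v y - w y| < |v x - w x| + ε / (2 * (K + 1)) :=
    (hv.continuous.sub hw.continuous).abs.continuousAt.eventually_lt continuousAt_const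
      (by simpa using hδ)
  filter_upwards [ha (ε / 2) (by positivity), hb (ε / 2) (by positivity), hcont] with y h1 h2 h3
  have h4 := hχ.dist_le_mul y x
  rw [Real.dist_eq] at h4
  have h5 : χ y * v y + (1 - χ y) * w y - (χ x * v x + (1 - χ x) * w x) =
      χ x * (v y - v x) + (1 - χ x) * (w y - w x) + (χ y - χ x) * (v y - w y) := by ring
  rw [h5]
  refine (abs_add_three _ _ _).trans ?_
  rw [abs_mul, abs_mul, abs_mul, abs_of_nonneg hx0, abs_of_nonneg hx1]
  have h6 := mul_le_mul_of_nonneg_left h1 hx0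
  have h7 := mul_le_mul_of_nonneg_left h2 hx1
  have h8 := mul_le_mul h4 h3.le (abs_nonneg _) (by positivity)
  have h9 : K * (ε / (2 * (K + 1))) ≤ ε / 2 := by
    rw [mul_div_assoc', div_le_div_iff₀ (by positivity) two_pos]
    nlinarith [K.coe_nonneg]
  have h10 := mul_le_mul_of_nonneg_right h9 (dist_nonneg (x := y) (y := x))
  nlinarith

/-- The function `t ↦ t - max (-ε) (min ε t)`. -/
noncomputable def softThreshold (ε t : ℝ) : ℝ := t - max (-ε) (min ε t)

theorem softThreshold_zero {ε : ℝ} (hε : 0 ≤ ε) : softThreshold ε 0 = 0 := by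
  simp [softThreshold, hε]

theorem softThreshold_eq_zero {ε t : ℝ} (h : |t| ≤ ε) : softThreshold ε t = 0 := by
  rw [abs_le] at h
  simp [softThreshold, h.1, h.2]

theorem abs_softThreshold_sub_le {ε : ℝ} (hε : 0 ≤ ε) (s t : ℝ) :
    |softThreshold ε s - softThreshold ε t| ≤ |s - t| := by
  simp only [softThreshold]
  rcases le_total s t with h | h
  · rw [abs_of_nonpos (by linarith : s - t ≤ 0), abs_le]
    constructor <;> (simp only [max_def, min_def]; split_ifs <;> linarith)
  · rw [abs_of_nonneg (by linarith : 0 ≤ s - t), abs_le]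
    constructor <;> (simp only [max_def, min_def]; split_ifs <;> linarith)

theorem abs_softThreshold_sub_self_le {ε : ℝ} (hε : 0 ≤ ε) (t : ℝ) :
    |softThreshold ε t - t| ≤ ε ∧ |softThreshold ε t - t| ≤ |t| := by
  simp only [softThreshold]
  rw [sub_right_comm, sub_self, zero_sub, abs_neg]
  refine ⟨abs_le.2 ⟨le_max_left _ _, max_le (by linarith) (min_le_left _ _)⟩, ?_⟩
  rcases le_total 0 t with h | h
  · rw [abs_of_nonneg h, max_eq_right (by linarith [le_min hε h]), abs_of_nonneg (le_min hε h)]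
    exact min_le_right _ _
  · rw [abs_of_nonpos h, min_eq_right (by linarith), abs_of_nonpos (max_le (by linarith) h)]
    linarith [le_max_right (-ε) t]

theorem lipschitzWith_softThreshold {ε : ℝ} (hε : 0 ≤ ε) : LipschitzWith 1 (softThreshold ε) :=
  LipschitzWith.of_dist_le_mul fun s t => by
    simpa [Real.dist_eq] using abs_softThreshold_sub_le hε s t

theorem IsLipBS.softThreshold {ε : ℝ} (hε : 0 ≤ ε) {v : X → ℝ} (hv : IsLipBS v) :
    IsLipBS fun x => softThreshold ε (v x) := by
  obtain ⟨⟨K, hK⟩, hs⟩ := hv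
  refine ⟨⟨1 * K, (lipschitzWith_softThreshold hε).comp hK⟩, hs.subset fun x hx hx' => hx ?_⟩
  simp [hx', softThreshold_zero hε]

/-- Truncation is 1-Lipschitz, and the set `{|v| < ε}` is open, so the truncated function is zero in
a neighbourhood of each of its points. -/
theorem toReal_lipConst_softThreshold_le {ε : ℝ} (hε : 0 < ε) {v : X → ℝ} (hv : IsLipBS v)
    {x : X} {a : ℝ} (ha : (lipConst v x).toReal ≤ a) :
    (lipConst (fun x => softThreshold ε (v x)) x).toReal ≤
      {x | ε ≤ |v x|}.indicator 1 x * a := by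
  have ha0 : 0 ≤ a := ENNReal.toReal_nonneg.trans ha
  rw [(hv.softThreshold hε.le).toReal_lipConst_le_iff
    (mul_nonneg (indicator_one_nonneg _ _) ha0)]
  rw [hv.toReal_lipConst_le_iff ha0] at ha
  intro δ hδ
  by_cases hx : ε ≤ |v x|
  · filter_upwards [ha δ hδ] with y hy
    simp only [Set.indicator, Set.mem_ofPred_eq, hx, if_true, Pi.one_apply, one_mul]
    exact (abs_softThreshold_sub_le hε.le _ _).trans hy
  · have : ∀ᶠ y in 𝓝 x, |v y| < ε :=
      hv.continuous.abs.continuousAt.eventually_lt continuousAt_const (not_le.1 hx)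
    filter_upwards [this] with y hy
    rw [softThreshold_eq_zero hy.le, softThreshold_eq_zero (not_le.1 hx).le, sub_self, abs_zero]
    exact mul_nonneg (add_nonneg (mul_nonneg (indicator_one_nonneg _ _) ha0) hδ.le) dist_nonneg

/-! ### Relaxed slopes: closedness, gluing, minimality, locality. -/

variable [MeasurableSpace X] {μ : Measure X}

/-- The pairs `(u, H)` with `u` Lipschitz with bounded support and `H ≥ lip u`. -/
def lipPairs (μ : Measure X) : Set (Lp ℝ 2 μ × Lp ℝ 2 μ) :=
  {p | ∃ v : X → ℝ, IsLipBS v ∧ p.1 =ᵐ[μ] v ∧ ∀ᵐ x ∂μ, (lipConst v x).toReal ≤ p.2 x}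

/-- Describing relaxed slopes as a closure in `L² × L²` makes diagonal arguments unnecessary:
stability under strong limits is closedness. -/
theorem isRelaxedSlope_iff_mem_closure {f G : Lp ℝ 2 μ} :
    IsRelaxedSlope μ f G ↔ (f, G) ∈ closure (lipPairs μ) := by
  rw [mem_closure_iff_seq_limit]
  constructor
  · rintro ⟨v, u, H, hv, hu, hH, hf, hG⟩
    exact ⟨fun n => (u n, H n), fun n => ⟨v n, hv n, hu n, hH n⟩, hf.prodMk_nhds hG⟩
  · rintro ⟨p, hp, hl⟩
    choose v hv hu hH using hp
    exact ⟨v, fun n => (p n).1, fun n => (p n).2, hv, hu, hH,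
      (continuous_fst.tendsto _).comp hl, (continuous_snd.tendsto _).comp hl⟩

theorem IsRelaxedSlope.of_tendsto {f G : Lp ℝ 2 μ} {u H : ℕ → Lp ℝ 2 μ}
    (h : ∀ n, IsRelaxedSlope μ (u n) (H n)) (hf : Tendsto u atTop (𝓝 f))
    (hG : Tendsto H atTop (𝓝 G)) : IsRelaxedSlope μ f G := by
  rw [isRelaxedSlope_iff_mem_closure]
  exact isClosed_closure.mem_of_tendsto (hf.prodMk_nhds hG)
    (Eventually.of_forall fun n => isRelaxedSlope_iff_mem_closure.1 (h n))

theorem convex_isRelaxedSlope (f : Lp ℝ 2 μ) : Convex ℝ {G | IsRelaxedSlope μ f G} := by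
  intro G hG H hH a b ha hb hab
  have := (IsRelaxedSlope.smul hG a).add (IsRelaxedSlope.smul hH b)
  rwa [abs_of_nonneg ha, abs_of_nonneg hb, ← add_smul, hab, one_smul] at this

theorem isClosed_isRelaxedSlope (f : Lp ℝ 2 μ) : IsClosed {G | IsRelaxedSlope μ f G} := by
  have : {G | IsRelaxedSlope μ f G} = (fun G => (f, G)) ⁻¹' closure (lipPairs μ) := by
    ext G
    exact isRelaxedSlope_iff_mem_closure
  rw [this]
  exact isClosed_closure.preimage (by fun_prop)

theorem isRelaxedSlope_of_isLipBS {v : X → ℝ} {f G : Lp ℝ 2 μ} (hv : IsLipBS v) (hf : f =ᵐ[μ] v)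
    (hG : ∀ᵐ x ∂μ, (lipConst v x).toReal ≤ G x) : IsRelaxedSlope μ f G :=
  isRelaxedSlope_iff_mem_closure.2 (subset_closure ⟨v, hv, hf, hG⟩)

theorem minSlope_le {f : sobolev μ} {G : Lp ℝ 2 μ} (h : IsRelaxedSlope μ f G) : minSlope f ≤ G :=
  (isGLB_minSlope f).1 h

theorem norm_minSlope_le {f : sobolev μ} {G : Lp ℝ 2 μ} (h : IsRelaxedSlope μ f G) :
    ‖minSlope f‖ ≤ ‖G‖ := by
  apply norm_le_norm_of_abs_le_abs
  rw [abs_of_nonneg (minSlope_nonneg f), abs_of_nonneg h.nonneg]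
  exact minSlope_le h

theorem norm_minSlope_sub_minSlope_le (f g : sobolev μ) :
    ‖minSlope f - minSlope g‖ ≤ ‖minSlope (f - g)‖ := by
  apply norm_le_norm_of_abs_le_abs
  rw [abs_of_nonneg (minSlope_nonneg (f - g)), abs_le']
  constructor
  · rw [sub_le_iff_le_add]
    simpa using minSlope_add_le (f - g) g
  · rw [neg_sub, sub_le_iff_le_add, ← minSlope_neg (f - g)]
    simpa using minSlope_add_le (-(f - g)) f

variable [BorelSpace X]

/-- Interpolating with `χ` between two approximating sequences of the same `f` costs the Leibniz
error `K |uₙ - u'ₙ|`, which tends to zero in `L²`. -/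
theorem IsRelaxedSlope.glue_lipschitz {χ : X → ℝ} {K : ℝ≥0} (hχ : LipschitzWith K χ)
    (h0 : ∀ x, 0 ≤ χ x) (h1 : ∀ x, χ x ≤ 1) {f F G : Lp ℝ 2 μ} (hF : IsRelaxedSlope μ f F)
    (hG : IsRelaxedSlope μ f G) :
    IsRelaxedSlope μ f (glue μ χ hχ.continuous.measurable h0 h1 F G) := by
  obtain ⟨v, u, H, hv, hu, hH, huf, hHF⟩ := hF
  obtain ⟨v', u', H', hv', hu', hH', huf', hHG⟩ := hG
  set γ := glue μ χ hχ.continuous.measurable h0 h1 with hγ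
  have hcont : ∀ {a b : ℕ → Lp ℝ 2 μ} {a₀ b₀}, Tendsto a atTop (𝓝 a₀) → Tendsto b atTop (𝓝 b₀) →
      Tendsto (fun n => γ (a n) (b n)) atTop (𝓝 (γ a₀ b₀)) := fun ha hb =>
    (((mulLp μ χ _ _).continuous.tendsto _).comp ha).add
      (((mulLp μ (fun x => 1 - χ x) _ _).continuous.tendsto _).comp hb)
  have hlb : ∀ n, IsLipBS fun x => χ x * v n x + (1 - χ x) * v' n x := fun n =>
    ((hv n).mul_left hχ (abs_le_one_of_nonneg h0 h1)).add
      ((hv' n).mul_left ((LipschitzWith.const 1).sub hχ) (abs_one_sub_le_one h0 h1))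
  refine ⟨fun n x => χ x * v n x + (1 - χ x) * v' n x, fun n => γ (u n) (u' n),
    fun n => γ (H n) (H' n) + (K : ℝ) • |u n - u' n|, hlb, fun n => ?_, fun n => ?_, ?_, ?_⟩
  · filter_upwards [coeFn_glue χ hχ.continuous.measurable h0 h1 (u n) (u' n), hu n, hu' n]
      with x a b c
    rw [hγ, a, b, c]
  · filter_upwards [coeFn_glue χ hχ.continuous.measurable h0 h1 (H n) (H' n), hu n, hu' n,
      hH n, hH' n, Lp.coeFn_add (γ (H n) (H' n)) ((K : ℝ) • |u n - u' n|),
      Lp.coeFn_smul (K : ℝ) |u n - u' n|, Lp.coeFn_abs (u n - u' n), Lp.coeFn_sub (u n) (u' n)]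
      with x a b c d e f g h i
    rw [f, Pi.add_apply, g, Pi.smul_apply, h, i, Pi.sub_apply, b, c, hγ, a, smul_eq_mul]
    exact toReal_lipConst_glue_le hχ h0 h1 (hv n) (hv' n) (hlb n) d e
  · simpa [hγ, glue_self] using hcont huf huf'
  · have h3 : Tendsto (fun n => (K : ℝ) • |u n - u' n|) atTop (𝓝 0) := by
      rw [tendsto_zero_iff_norm_tendsto_zero]
      simpa [norm_smul, norm_abs_eq_norm] using (huf.sub huf').norm.const_mul (K : ℝ)
    simpa using (hcont hHF hHG).add h3

/-- Induction on Borel sets. Indicators of closed sets are limits of Lipschitz cut-offs, complements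
exchange `F` and `G`, and countable unions are limits of finite ones, which are glued one set at a
time. The slopes must vary in the induction for the last two cases. -/
theorem IsRelaxedSlope.glue_indicator {B : Set X} (hB : MeasurableSet B) {f F G : Lp ℝ 2 μ}
    (hF : IsRelaxedSlope μ f F) (hG : IsRelaxedSlope μ f G) :
    IsRelaxedSlope μ f (glue μ (B.indicator 1) (measurable_one.indicator hB)
      (indicator_one_nonneg B) (indicator_one_le_one B) F G) := by
  induction B, hB using MeasurableSpace.induction_on_inter
    (h_eq := (BorelSpace.measurable_eq (α := X)).trans borel_eq_generateFrom_isClosed)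
    isPiSystem_isClosed generalizing F G with
  | empty =>
    convert hG
    apply Lp.ext
    filter_upwards [coeFn_glue (μ := μ) ((∅ : Set X).indicator 1)
      (measurable_one.indicator MeasurableSet.empty) (indicator_one_nonneg _)
      (indicator_one_le_one _) F G] with x hx
    rw [hx]
    simp
  | basic C hC =>
    have hδ : ∀ n : ℕ, (0 : ℝ) < 1 / ((n : ℝ) + 1) := fun n => by positivity
    have ht := thickenedIndicator_tendsto_indicator_closure hδ
      tendsto_one_div_add_atTop_nhds_zero_nat C
    rw [tendsto_pi_nhds] at ht
    have hLip : ∀ n : ℕ, LipschitzWith (1 / ((n : ℝ) + 1)).toNNReal⁻¹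
        (fun x => ((thickenedIndicator (hδ n) C x : ℝ≥0) : ℝ)) := fun n =>
      lipschitzWith_thickenedIndicator (hδ n) C
    have hle : ∀ n x, ((thickenedIndicator (hδ n) C x : ℝ≥0) : ℝ) ≤ 1 := fun n x =>
      NNReal.coe_le_one.2 (thickenedIndicator_le_one (hδ n) C x)
    refine IsRelaxedSlope.of_tendsto
      (fun n => IsRelaxedSlope.glue_lipschitz (hLip n) (fun x => NNReal.coe_nonneg _) (hle n)
        hF hG) tendsto_const_nhds (tendsto_glue _ _ _ _ _ _ _ _ fun x => ?_)
    have hx := (NNReal.continuous_coe.tendsto _).comp (ht x)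
    rw [IsClosed.closure_eq hC] at hx
    have hc : ((C.indicator (fun _ => 1) x : ℝ≥0) : ℝ) = C.indicator 1 x := by
      by_cases h : x ∈ C <;> simp [h]
    rwa [hc] at hx
  | compl C hC ih =>
    convert ih hG hF using 1
    apply Lp.ext
    filter_upwards [coeFn_glue (μ := μ) (Cᶜ.indicator 1) (measurable_one.indicator hC.compl)
      (indicator_one_nonneg _) (indicator_one_le_one _) F G,
      coeFn_glue (μ := μ) (C.indicator 1) (measurable_one.indicator hC)
      (indicator_one_nonneg _) (indicator_one_le_one _) G F] with x hx hx'
    rw [hx, hx']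
    by_cases h : x ∈ C <;> simp [h]
  | iUnion B hd hm ih =>
    have hpart : ∀ n, MeasurableSet (⋃ i ∈ Finset.range n, B i) := fun n =>
      Finset.measurableSet_biUnion _ fun i _ => hm i
    have hstep : ∀ n, IsRelaxedSlope μ f (glue μ ((⋃ i ∈ Finset.range n, B i).indicator 1)
        (measurable_one.indicator (hpart n)) (indicator_one_nonneg _) (indicator_one_le_one _)
        F G) := by
      intro n
      induction n with
      | zero =>
        convert hG
        apply Lp.ext
        filter_upwards [coeFn_glue (μ := μ) ((⋃ i ∈ Finset.range 0, B i).indicator 1)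
          (measurable_one.indicator (hpart 0)) (indicator_one_nonneg _)
          (indicator_one_le_one _) F G] with x hx
        rw [hx]
        simp
      | succ n ihn =>
        convert ih n hF ihn using 1
        apply Lp.ext
        filter_upwards [coeFn_glue (μ := μ) ((⋃ i ∈ Finset.range (n + 1), B i).indicator 1)
            (measurable_one.indicator (hpart (n + 1))) (indicator_one_nonneg _)
            (indicator_one_le_one _) F G,
          coeFn_glue (μ := μ) ((⋃ i ∈ Finset.range n, B i).indicator 1)
            (measurable_one.indicator (hpart n)) (indicator_one_nonneg _)
            (indicator_one_le_one _) F G,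
          coeFn_glue (μ := μ) ((B n).indicator 1)
            (measurable_one.indicator (hm n)) (indicator_one_nonneg _)
            (indicator_one_le_one _) F (glue μ ((⋃ i ∈ Finset.range n, B i).indicator 1)
        (measurable_one.indicator (hpart n)) (indicator_one_nonneg _) (indicator_one_le_one _)
        F G)] with x h1 h2 h3
        rw [h1, h3, h2, Finset.range_add_one, Finset.set_biUnion_insert]
        by_cases h : x ∈ B n
        · rw [Set.indicator_of_mem h, Set.indicator_of_mem (Set.mem_union_left _ h)]
          simp
        · have hiff : (B n ∪ ⋃ i ∈ Finset.range n, B i).indicator (1 : X → ℝ) x =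
              (⋃ i ∈ Finset.range n, B i).indicator 1 x := by
            by_cases h' : x ∈ ⋃ i ∈ Finset.range n, B i
            · rw [Set.indicator_of_mem h', Set.indicator_of_mem (Set.mem_union_right _ h')]
            · rw [Set.indicator_of_notMem h', Set.indicator_of_notMem]
              exact fun h'' => h''.elim h h'
          rw [Set.indicator_of_notMem h, hiff]
          ring
    refine IsRelaxedSlope.of_tendsto hstep tendsto_const_nhds
      (tendsto_glue _ _ _ _ _ _ _ _ fun x => ?_)
    by_cases hx : x ∈ ⋃ i, B i
    · obtain ⟨i, hi⟩ := Set.mem_iUnion.1 hx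
      refine tendsto_const_nhds.congr' ?_
      filter_upwards [eventually_gt_atTop i] with n hn
      rw [Set.indicator_of_mem hx, Set.indicator_of_mem]
      exact Set.mem_biUnion (Finset.mem_range.2 hn) hi
    · rw [Set.indicator_of_notMem hx]
      refine tendsto_const_nhds.congr fun n => ?_
      rw [Set.indicator_of_notMem]
      intro h
      simp only [Set.mem_iUnion] at h hx
      obtain ⟨i, -, hi⟩ := h
      exact hx ⟨i, hi⟩

/-- The minimum is `F` glued to `G` along `{F < G}`. -/
theorem IsRelaxedSlope.inf {f F G : Lp ℝ 2 μ} (hF : IsRelaxedSlope μ f F)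
    (hG : IsRelaxedSlope μ f G) : IsRelaxedSlope μ f (F ⊓ G) := by
  have hB : MeasurableSet {x | F x < G x} := measurableSet_lt
    (Lp.stronglyMeasurable F).measurable (Lp.stronglyMeasurable G).measurable
  convert IsRelaxedSlope.glue_indicator hB hF hG using 1
  apply Lp.ext
  filter_upwards [Lp.coeFn_inf F G, coeFn_glue (μ := μ) ({x | F x < G x}.indicator 1)
      (measurable_one.indicator hB) (indicator_one_nonneg _) (indicator_one_le_one _) F G]
    with x h1 h2
  rw [h1, h2]
  by_cases h : F x < G x
  · simp [Set.indicator, h, h.le]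
  · simp [Set.indicator, h, not_lt.1 h]

/-- The minimal relaxed slope is a relaxed slope. -/
theorem isRelaxedSlope_minSlope (f : sobolev μ) : IsRelaxedSlope μ f (minSlope f) := by
  obtain ⟨G, hG, hmin⟩ := exists_norm_eq_iInf_of_complete_convex (K := {G | IsRelaxedSlope μ f G})
    f.2 (isClosed_isRelaxedSlope _).isComplete (convex_isRelaxedSlope _) 0
  simp only [zero_sub, norm_neg] at hmin
  have hle : ∀ H, IsRelaxedSlope μ f H → ‖G‖ ≤ ‖H‖ := fun H hH => by
    rw [hmin]
    exact ciInf_le (f := fun w : {G | IsRelaxedSlope μ (f : Lp ℝ 2 μ) G} => ‖(w : Lp ℝ 2 μ)‖)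
      ⟨0, by rintro _ ⟨w, rfl⟩; exact norm_nonneg _⟩ ⟨H, hH⟩
  -- The element of least norm lies below every other slope `H`: `G ⊓ H` is a slope of no larger
  -- norm, and by the parallelogram law the midpoint of `G` and `G ⊓ H` would be strictly shorter
  -- than `G` unless the two coincide.
  have hlow : ∀ H, IsRelaxedSlope μ f H → G ≤ H := by
    intro H hH
    have hI := IsRelaxedSlope.inf hG hH
    have hmid : IsRelaxedSlope μ f ((1 / 2 : ℝ) • G + (1 / 2 : ℝ) • (G ⊓ H)) :=
      convex_isRelaxedSlope _ hG hI (by norm_num) (by norm_num) (by norm_num)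
    have h1 := hle _ hmid
    have h2 : ‖G ⊓ H‖ ≤ ‖G‖ := by
      apply norm_le_norm_of_abs_le_abs
      rw [abs_of_nonneg hI.nonneg, abs_of_nonneg hG.nonneg]
      exact inf_le_left
    have h3 := parallelogram_law_with_norm ℝ G (G ⊓ H)
    rw [← smul_add, norm_smul, Real.norm_of_nonneg (by norm_num : (0 : ℝ) ≤ 1 / 2)] at h1
    have h4 : ‖G - G ⊓ H‖ * ‖G - G ⊓ H‖ ≤ 0 := by nlinarith [norm_nonneg G, norm_nonneg (G ⊓ H)]
    have h5 : G - G ⊓ H = 0 := by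
      rw [← norm_eq_zero]
      nlinarith [norm_nonneg (G - G ⊓ H)]
    exact inf_eq_left.1 (sub_eq_zero.1 h5).symm
  have : minSlope f = G := (isGLB_minSlope f).unique ⟨hlow, fun L hL => hL hG⟩
  rwa [this]

theorem minSlope_smul_le (c : ℝ) (f : sobolev μ) : minSlope (c • f) ≤ |c| • minSlope f :=
  minSlope_le ((isRelaxedSlope_minSlope f).smul c)

theorem IsRelaxedSlope.softThreshold {ε : ℝ} (hε : 0 < ε) {f G : Lp ℝ 2 μ}
    (h : IsRelaxedSlope μ f G) (hm : MeasurableSet {x | ε ≤ |f x|}) :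
    IsRelaxedSlope μ
      ((lipschitzWith_softThreshold hε.le).compLp (softThreshold_zero hε.le) f)
      (mulLp μ ({x | ε ≤ |f x|}.indicator 1) (measurable_one.indicator hm)
        (abs_le_one_of_nonneg (indicator_one_nonneg _) (indicator_one_le_one _)) G) := by
  obtain ⟨v, u, H, hv, hu, hH, hf, hG⟩ := h
  obtain ⟨ns, hns, hae⟩ := (tendstoInMeasure_of_tendsto_Lp hf).exists_seq_tendsto_ae
  -- The slope of the truncated `v n` lives on `{ε ≤ |v n|}`, but these indicators need not converge
  -- where `|f| = ε`. Adding `{ε ≤ |f|}` makes them constantly 1 there, while they are eventually 0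
  -- almost everywhere on `{|f| < ε}`.
  have hmc : ∀ n, MeasurableSet ({x | ε ≤ |v n x|} ∪ {x | ε ≤ |f x|}) := fun n =>
    (measurableSet_le measurable_const
      ((hv n).continuous.measurable.abs)).union hm
  set c : ℕ → Lp ℝ 2 μ →L[ℝ] Lp ℝ 2 μ := fun n =>
    mulLp μ (({x | ε ≤ |v n x|} ∪ {x | ε ≤ |f x|}).indicator 1)
      (measurable_one.indicator (hmc n))
      (abs_le_one_of_nonneg (indicator_one_nonneg _) (indicator_one_le_one _)) with hc
  refine ⟨fun n x => WeightedHajlasz.softThreshold ε (v (ns n) x),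
    fun n => (lipschitzWith_softThreshold hε.le).compLp (softThreshold_zero hε.le) (u (ns n)),
    fun n => c (ns n) (H (ns n)), fun n => (hv _).softThreshold hε.le, fun n => ?_, fun n => ?_,
    ?_, ?_⟩
  · filter_upwards [(lipschitzWith_softThreshold hε.le).coeFn_compLp (softThreshold_zero hε.le)
      (u (ns n)), hu (ns n)] with x h1 h2
    rw [h1, Function.comp_apply, h2]
  · filter_upwards [hH (ns n), coeFn_mulLp _ (measurable_one.indicator (hmc (ns n)))
      (abs_le_one_of_nonneg (indicator_one_nonneg _) (indicator_one_le_one _)) (H (ns n))]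
      with x h1 h2
    refine (toReal_lipConst_softThreshold_le hε (hv _) h1).trans ?_
    rw [hc, h2]
    refine mul_le_mul_of_nonneg_right ?_ (ENNReal.toReal_nonneg.trans h1)
    exact Set.indicator_le_indicator_of_subset Set.subset_union_left (fun _ => zero_le_one) x
  · exact (((lipschitzWith_softThreshold hε.le).continuous_compLp
      (softThreshold_zero hε.le)).tendsto f).comp (hf.comp hns.tendsto_atTop)
  -- Both factors of `c (ns n) (H (ns n))` vary. The multipliers are contractions, so `H (ns n)` may
  -- be replaced by `G`, and then only the indicators move.
  · have h1 : Tendsto (fun n => c (ns n) (H (ns n) - G)) atTop (𝓝 0) := by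
      have h0 : Tendsto (fun n => H (ns n) - G) atTop (𝓝 0) := by
        simpa using (hG.comp hns.tendsto_atTop).sub_const G
      exact squeeze_zero_norm (fun n => norm_mulLp_le _ _ _ _) (by simpa using h0.norm)
    have h2 := tendsto_mulLp (μ := μ) (fun n => measurable_one.indicator (hmc (ns n)))
      (fun n => abs_le_one_of_nonneg (indicator_one_nonneg _) (indicator_one_le_one _))
      (measurable_one.indicator hm)
      (abs_le_one_of_nonneg (indicator_one_nonneg _) (indicator_one_le_one _)) G (by
        filter_upwards [hae, ae_all_iff.2 hu] with x hx hux
        simp only [hux] at hx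
        by_cases hfx : ε ≤ |f x|
        · simp [Set.indicator, hfx]
        · have := hx.abs.eventually_lt_const (not_le.1 hfx)
          refine tendsto_const_nhds.congr' ?_
          filter_upwards [this] with n hn
          simp [Set.indicator, hfx, not_le.2 hn])
    have h3 := h1.add h2
    rw [zero_add] at h3
    refine h3.congr fun n => ?_
    rw [hc]
    simp only [map_sub]
    abel

/-- Let the threshold tend to zero: the truncations converge to `f` in `L²` and the sets `{ε ≤ |f|}`
increase to `{f ≠ 0}`. -/
theorem IsRelaxedSlope.indicator_ne_zero {f G : Lp ℝ 2 μ} (h : IsRelaxedSlope μ f G)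
    (hm : MeasurableSet {x | f x ≠ 0}) :
    IsRelaxedSlope μ f (mulLp μ ({x | f x ≠ 0}.indicator 1) (measurable_one.indicator hm)
        (abs_le_one_of_nonneg (indicator_one_nonneg _) (indicator_one_le_one _)) G) := by
  have hδ : ∀ n : ℕ, (0 : ℝ) < 1 / ((n : ℝ) + 1) := fun n => by positivity
  have hm' : ∀ n : ℕ, MeasurableSet {x | 1 / ((n : ℝ) + 1) ≤ |f x|} := fun n =>
    measurableSet_le measurable_const (Lp.stronglyMeasurable f).measurable.abs
  refine IsRelaxedSlope.of_tendsto (fun n => h.softThreshold (hδ n) (hm' n)) ?_ ?_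
  · have hae := ae_all_iff.2 fun n : ℕ => (lipschitzWith_softThreshold (hδ n).le).coeFn_compLp
      (softThreshold_zero (hδ n).le) f
    refine tendsto_Lp_two_of_dominated (b := f) (fun n => ?_) ?_
    · filter_upwards [hae] with x hx
      rw [hx, Function.comp_apply]
      exact (abs_softThreshold_sub_self_le (hδ n).le _).2
    · filter_upwards [hae] with x hx
      simp only [hx, Function.comp_apply]
      rw [tendsto_iff_dist_tendsto_zero]
      exact squeeze_zero (fun n => dist_nonneg)
        (fun n => (abs_softThreshold_sub_self_le (hδ n).le _).1)
        tendsto_one_div_add_atTop_nhds_zero_nat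
  · refine tendsto_mulLp _ _ _ _ _ (Eventually.of_forall fun x => ?_)
    by_cases hx : f x = 0
    · refine tendsto_const_nhds.congr fun n => ?_
      rw [Set.indicator_of_notMem (by simp [hx]), Set.indicator_of_notMem]
      simpa [hx] using hδ n
    · have := tendsto_one_div_add_atTop_nhds_zero_nat (𝕜 := ℝ) |>.eventually_le_const
        (abs_pos.2 hx)
      refine tendsto_const_nhds.congr' ?_
      filter_upwards [this] with n hn
      simp only [Set.indicator, Set.mem_ofPred_eq, hn, hx, ne_eq, not_false_eq_true, if_true]

/-- Locality of the minimal relaxed slope. -/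
theorem minSlope_eq_zero_of_eq_zero (f : sobolev μ) :
    ∀ᵐ x ∂μ, (f : Lp ℝ 2 μ) x = 0 → minSlope f x = 0 := by
  have hm : MeasurableSet {x | (f : Lp ℝ 2 μ) x ≠ 0} :=
    (measurableSet_eq_fun (Lp.stronglyMeasurable _).measurable measurable_const).compl
  have h1 := minSlope_le ((isRelaxedSlope_minSlope f).indicator_ne_zero hm)
  filter_upwards [(Lp.coeFn_le _ _).2 h1, (Lp.coeFn_nonneg _).2 (minSlope_nonneg f),
    coeFn_mulLp _ (measurable_one.indicator hm)
        (abs_le_one_of_nonneg (indicator_one_nonneg _) (indicator_one_le_one _)) (minSlope f)]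
    with x a b c hx
  rw [c] at a
  simp only [Set.indicator, Set.mem_ofPred_eq, hx, ne_eq, not_true_eq_false, if_false, zero_mul]
    at a
  exact le_antisymm a b

theorem minSlope_eq_zero_of_eq {f g : sobolev μ} {A : Set X}
    (h : ∀ᵐ x ∂μ, x ∈ A → (f : Lp ℝ 2 μ) x = (g : Lp ℝ 2 μ) x) :
    ∀ᵐ x ∂μ, x ∈ A → minSlope (f - g) x = 0 := by
  filter_upwards [h, minSlope_eq_zero_of_eq_zero (f - g),
    Lp.coeFn_sub (f : Lp ℝ 2 μ) (g : Lp ℝ 2 μ)] with x h1 h2 h3 hx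
  refine h2 ?_
  change ((f : Lp ℝ 2 μ) - (g : Lp ℝ 2 μ) : Lp ℝ 2 μ) x = 0
  rw [h3, Pi.sub_apply, h1 hx, sub_self]

/-- Completeness of the Sobolev space. -/
theorem exists_tendsto_of_cauchy_sobolev {g : ℕ → sobolev μ}
    (hg : ∀ ε > 0, ∃ N, ∀ m ≥ N, ∀ n ≥ N,
      ‖g m - g n‖ ≤ ε ∧ ‖minSlope (g m - g n)‖ ≤ ε) :
    ∃ g₀ : sobolev μ, Tendsto (fun n => (g n : Lp ℝ 2 μ)) atTop (𝓝 (g₀ : Lp ℝ 2 μ)) ∧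
      Tendsto (fun n => ‖minSlope (g n - g₀)‖) atTop (𝓝 0) := by
  have hc : CauchySeq fun n => (g n : Lp ℝ 2 μ) := by
    rw [Metric.cauchySeq_iff]
    intro ε hε
    obtain ⟨N, hN⟩ := hg (ε / 2) (half_pos hε)
    refine ⟨N, fun m hm n hn => ?_⟩
    rw [dist_eq_norm]
    exact (hN m hm n hn).1.trans_lt (half_lt_self hε)
  obtain ⟨u, hu⟩ := cauchySeq_tendsto_of_complete hc
  -- For fixed `n` the slopes of `g m - g n` are Cauchy in `m` by the reverse triangle inequality.
  -- Their limit is a relaxed slope of `u - g n`, which puts `u` in the Sobolev space and controls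
  -- the distance to `g n`.
  have hk : ∀ n, ∃ Γ : Lp ℝ 2 μ, Tendsto (fun m => minSlope (g m - g n)) atTop (𝓝 Γ) := by
    intro n
    refine cauchySeq_tendsto_of_complete ?_
    rw [Metric.cauchySeq_iff]
    intro ε hε
    obtain ⟨N, hN⟩ := hg (ε / 2) (half_pos hε)
    refine ⟨N, fun m hm k hk => ?_⟩
    rw [dist_eq_norm]
    refine (norm_minSlope_sub_minSlope_le _ _).trans_lt ?_
    rw [sub_sub_sub_cancel_right]
    exact (hN m hm k hk).2.trans_lt (half_lt_self hε)
  choose Γ hΓ using hk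
  have hslope : ∀ n, IsRelaxedSlope μ (u - g n) (Γ n) := fun n =>
    IsRelaxedSlope.of_tendsto (fun m => isRelaxedSlope_minSlope (g m - g n))
      (hu.sub_const _) (hΓ n)
  have hu_mem : u ∈ sobolev μ := by
    have h1 : u - g 0 ∈ sobolev μ := ⟨_, hslope 0⟩
    simpa using (sobolev μ).add_mem h1 (g 0).2
  refine ⟨⟨u, hu_mem⟩, hu, ?_⟩
  rw [Metric.tendsto_atTop]
  intro ε hε
  obtain ⟨N, hN⟩ := hg (ε / 2) (half_pos hε)
  refine ⟨N, fun n hn => ?_⟩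
  rw [Real.dist_eq, sub_zero, abs_norm, ← minSlope_neg, neg_sub]
  refine lt_of_le_of_lt ?_ (half_lt_self hε)
  refine (norm_minSlope_le (hslope n)).trans ?_
  refine le_of_tendsto (hΓ n).norm ?_
  filter_upwards [eventually_ge_atTop N] with m hm
  exact (hN m hm n hn).2

end Slope

/-! ### The cotangent module: localisation, series, and uniqueness of local differentials. -/

section LocalDifferential

variable {X : Type*} [MetricSpace X] [MeasurableSpace X] {μ : Measure X}

noncomputable instance SimpleForm.module (μ : Measure X) : Module ℝ (SimpleForm μ) :=
  inferInstanceAs (Module ℝ (SimpleFunc X (sobolev μ)))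

/-- The constant simple form `dg`. -/
noncomputable def SimpleForm.const (g : sobolev μ) : SimpleForm μ := SimpleFunc.const X g

/-- Multiplication of simple forms by the indicator function of a set. -/
noncomputable def SimpleForm.restrictHom (μ : Measure X) (E : Set X) :
    SimpleForm μ →+ SimpleForm μ where
  toFun s := SimpleFunc.restrict (show SimpleFunc X (sobolev μ) from s) E
  map_zero' := by
    apply SimpleFunc.ext
    intro x
    -- The restriction to a non-measurable set is zero by convention, so the map is additive for
    -- every `E`.
    by_cases hE : MeasurableSet E
    · refine (SimpleFunc.restrict_apply _ hE x).trans ?_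
      exact congrFun (Set.indicator_zero (sobolev μ) E) x
    · rw [SimpleFunc.restrict_of_not_measurable hE]
      rfl
  map_add' s t := by
    by_cases hE : MeasurableSet E
    · apply SimpleFunc.ext
      intro x
      change (SimpleFunc.restrict (show SimpleFunc X (sobolev μ) from s + t) E) x =
        (SimpleFunc.restrict (show SimpleFunc X (sobolev μ) from s) E) x +
        (SimpleFunc.restrict (show SimpleFunc X (sobolev μ) from t) E) x
      rw [SimpleFunc.restrict_apply _ hE, SimpleFunc.restrict_apply _ hE,
        SimpleFunc.restrict_apply _ hE]
      exact congrFun (Set.indicator_add' E _ _) x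
    · rw [SimpleFunc.restrict_of_not_measurable hE, SimpleFunc.restrict_of_not_measurable hE,
        SimpleFunc.restrict_of_not_measurable hE]
      exact (add_zero (0 : SimpleForm μ)).symm

theorem SimpleForm.restrictHom_apply {E : Set X} (hE : MeasurableSet E) (s : SimpleForm μ)
    (x : X) : SimpleFunc.toFun (restrictHom μ E s) x = E.indicator (SimpleFunc.toFun s) x :=
  SimpleFunc.restrict_apply _ hE x

theorem SimpleForm.pointwiseNorm_restrictHom {E : Set X} (hE : MeasurableSet E)
    (s : SimpleForm μ) :
    ∀ᵐ x ∂μ, (restrictHom μ E s).pointwiseNorm x = E.indicator s.pointwiseNorm x := by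
  filter_upwards [pointwiseNorm_zero (μ := μ)] with x hx
  simp only [pointwiseNorm]
  rw [restrictHom_apply hE]
  by_cases h : x ∈ E
  · simp [h, pointwiseNorm]
  · rw [Set.indicator_of_notMem h, Set.indicator_of_notMem h]
    exact hx

theorem SimpleForm.pointwiseNorm_restrictHom_le (E : Set X) (s : SimpleForm μ) :
    ∀ᵐ x ∂μ, (restrictHom μ E s).pointwiseNorm x ≤ s.pointwiseNorm x := by
  by_cases hE : MeasurableSet E
  · filter_upwards [pointwiseNorm_restrictHom hE s, s.pointwiseNorm_nonneg] with x h1 h2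
    rw [h1]
    exact Set.indicator_le_self' (fun _ _ => h2) x
  · have : restrictHom μ E s = 0 := SimpleFunc.restrict_of_not_measurable hE
    rw [this]
    filter_upwards [pointwiseNorm_zero (μ := μ), s.pointwiseNorm_nonneg] with x h1 h2
    rwa [h1]

theorem SimpleForm.pointwiseNorm_smul_le [BorelSpace X] (c : ℝ) (s : SimpleForm μ) :
    ∀ᵐ x ∂μ, (c • s).pointwiseNorm x ≤ |c| * s.pointwiseNorm x :=
  s.ae_of_forall (p := fun f x => minSlope (c • f) x ≤ |c| * minSlope f x) fun f => by
    filter_upwards [(Lp.coeFn_le _ _).2 (minSlope_smul_le c f),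
      Lp.coeFn_smul |c| (minSlope f)] with x h1 h2
    rw [h2] at h1
    exact h1

variable [SFinite μ]

theorem SimpleForm.norm_eq (s : SimpleForm μ) :
    ‖s‖ = ∫ x, min 1 (s.pointwiseNorm x) ∂μ.toFinite := rfl

theorem SimpleForm.norm_le_of_ae_le {s t : SimpleForm μ}
    (h : ∀ᵐ x ∂μ, s.pointwiseNorm x ≤ t.pointwiseNorm x) : ‖s‖ ≤ ‖t‖ := by
  rw [norm_eq, norm_eq]
  rw [← ae_toFinite] at h
  refine integral_mono_ae s.integrable_min t.integrable_min ?_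
  filter_upwards [h] with x hx
  exact min_le_min_left _ hx

theorem SimpleForm.norm_restrictHom_le (E : Set X) (s : SimpleForm μ) :
    ‖restrictHom μ E s‖ ≤ ‖s‖ :=
  norm_le_of_ae_le (s.pointwiseNorm_restrictHom_le E)

/-- The truncation at 1 bounds every form supported in `E` by the finite measure of `E`, whatever
its size. This makes series over partitions summable and remainders on small sets negligible. -/
theorem SimpleForm.norm_restrictHom_le_measure {E : Set X} (hE : MeasurableSet E)
    (s : SimpleForm μ) : ‖restrictHom μ E s‖ ≤ μ.toFinite.real E := by
  rw [norm_eq, ← integral_indicator_one hE]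
  refine integral_mono_ae (restrictHom μ E s).integrable_min
    ((integrable_const (1 : ℝ)).indicator hE) ?_
  have := pointwiseNorm_restrictHom hE s
  rw [← ae_toFinite] at this
  filter_upwards [this] with x hx
  rw [hx]
  by_cases h : x ∈ E
  · simp [h]
  · simp [h]

variable (μ) in
/-- Multiplication by the indicator function of a set on the cotangent module. -/
noncomputable def res (E : Set X) : CotangentL0 μ →+ CotangentL0 μ :=
  (SimpleForm.restrictHom μ E).completion
    (AddMonoidHomClass.continuous_of_bound _ 1 fun s => by
      rw [one_mul]
      exact SimpleForm.norm_restrictHom_le E s)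

theorem continuous_res (E : Set X) : Continuous (res μ E) :=
  AddMonoidHom.continuous_completion _ _

theorem res_coe (E : Set X) (s : SimpleForm μ) :
    res μ E (s : CotangentL0 μ) = (SimpleForm.restrictHom μ E s : CotangentL0 μ) :=
  AddMonoidHom.completion_coe _ _ _

theorem chiD_eq_coe (E : Set X) (g : sobolev μ) :
    chiD μ E g = (SimpleForm.restrictHom μ E (SimpleForm.const g) :
      CotangentL0 μ) := rfl

theorem res_res {E F : Set X} (hE : MeasurableSet E) (hF : MeasurableSet F) (η : CotangentL0 μ) :
    res μ E (res μ F η) = res μ (E ∩ F) η := by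
  induction η using UniformSpace.Completion.induction_on with
  | hp => exact isClosed_eq ((continuous_res E).comp (continuous_res F)) (continuous_res _)
  | ih s =>
    rw [res_coe, res_coe, res_coe]
    congr 1
    apply SimpleFunc.ext
    intro x
    refine (SimpleForm.restrictHom_apply hE _ x).trans
      (Eq.trans ?_ (SimpleForm.restrictHom_apply (hE.inter hF) _ x).symm)
    rw [← Set.indicator_indicator]
    congr 1
    funext y
    exact SimpleForm.restrictHom_apply hF _ y

theorem res_chiD {E F : Set X} (hE : MeasurableSet E) (hF : MeasurableSet F) (g : sobolev μ) :
    res μ E (chiD μ F g) = chiD μ (E ∩ F) g := by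
  rw [chiD_eq_coe, chiD_eq_coe, ← res_coe, ← res_coe, res_res hE hF]

theorem res_add_res_compl {E : Set X} (hE : MeasurableSet E) (η : CotangentL0 μ) :
    res μ E η + res μ Eᶜ η = η := by
  induction η using UniformSpace.Completion.induction_on with
  | hp => exact isClosed_eq ((continuous_res E).add (continuous_res _)) continuous_id
  | ih s =>
    rw [res_coe, res_coe, ← UniformSpace.Completion.coe_add]
    congr 1
    apply SimpleFunc.ext
    intro x
    change SimpleFunc.toFun (SimpleForm.restrictHom μ E s) x +
      SimpleFunc.toFun (SimpleForm.restrictHom μ Eᶜ s) x = SimpleFunc.toFun s x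
    rw [SimpleForm.restrictHom_apply hE, SimpleForm.restrictHom_apply hE.compl]
    exact Set.indicator_self_add_compl_apply _ _ _

theorem norm_res_le_measure {E : Set X} (hE : MeasurableSet E) (η : CotangentL0 μ) :
    ‖res μ E η‖ ≤ μ.toFinite.real E := by
  induction η using UniformSpace.Completion.induction_on with
  | hp => exact isClosed_le (continuous_res E).norm continuous_const
  | ih s =>
    rw [res_coe, UniformSpace.Completion.norm_coe]
    exact SimpleForm.norm_restrictHom_le_measure hE s

theorem norm_chiD_le_measure {E : Set X} (hE : MeasurableSet E) (g : sobolev μ) :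
    ‖chiD μ E g‖ ≤ μ.toFinite.real E := by
  rw [chiD_eq_coe, UniformSpace.Completion.norm_coe]
  exact SimpleForm.norm_restrictHom_le_measure hE _

theorem chiD_empty (g : sobolev μ) : chiD μ ∅ g = 0 := by
  simpa using norm_chiD_le_measure MeasurableSet.empty g

theorem norm_chiD_le_integral (E : Set X) (g : sobolev μ) :
    ‖chiD μ E g‖ ≤ ∫ x, min 1 (minSlope g x) ∂μ.toFinite := by
  rw [chiD_eq_coe, UniformSpace.Completion.norm_coe]
  exact SimpleForm.norm_restrictHom_le _ _

theorem chiD_add (E : Set X) (g h : sobolev μ) : chiD μ E (g + h) = chiD μ E g + chiD μ E h := by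
  rw [chiD_eq_coe, chiD_eq_coe, chiD_eq_coe, ← UniformSpace.Completion.coe_add, ← map_add]
  rfl

theorem chiD_sub (E : Set X) (g h : sobolev μ) : chiD μ E (g - h) = chiD μ E g - chiD μ E h := by
  rw [eq_sub_iff_add_eq, ← chiD_add, sub_add_cancel]

/-- The form vanishes on finite unions of the `E j`, hence its norm is at most the finite measure of
their complements, which tends to zero. Overlaps are harmless, since each new set is split off
before the induction hypothesis is used. -/
theorem eq_zero_of_forall_res_eq_zero {E : ℕ → Set X} (hE : ∀ j, MeasurableSet (E j))
    (hcov : μ (⋃ j, E j)ᶜ = 0) {η : CotangentL0 μ} (h : ∀ j, res μ (E j) η = 0) : η = 0 := by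
  set S : ℕ → Set X := fun n => ⋃ i ∈ Finset.range n, E i with hS
  have hSm : ∀ n, MeasurableSet (S n) := fun n => Finset.measurableSet_biUnion _ fun i _ => hE i
  have hS0 : ∀ n, res μ (S n) η = 0 := by
    intro n
    induction n with
    | zero =>
      have := norm_res_le_measure (hSm 0) η
      simpa [hS] using this
    | succ n ih =>
      have h1 : E n ∩ S (n + 1) = E n := by
        rw [Set.inter_eq_left, hS]
        exact Set.subset_biUnion_of_mem (u := E) (Finset.mem_coe.2 (Finset.self_mem_range_succ n))
      have h2 : (E n)ᶜ ∩ S (n + 1) = (E n)ᶜ ∩ S n := by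
        ext x
        simp only [hS, Finset.range_add_one, Finset.set_biUnion_insert]
        constructor
        · rintro ⟨ha, hb | hb⟩
          · exact absurd hb ha
          · exact ⟨ha, hb⟩
        · rintro ⟨ha, hb⟩
          exact ⟨ha, Or.inr hb⟩
      rw [← res_add_res_compl (hE n) (res μ (S (n + 1)) η), res_res (hE n) (hSm _),
        res_res (hE n).compl (hSm _), h1, h2, h n, ← res_res (hE n).compl (hSm n), ih, map_zero,
        add_zero]
  have hle : ∀ n, ‖η‖ ≤ μ.toFinite.real (S n)ᶜ := fun n => by
    rw [← res_add_res_compl (hSm n) η, hS0 n, zero_add]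
    exact norm_res_le_measure (hSm n).compl η
  have hzero : μ.toFinite (⋂ n, (S n)ᶜ) = 0 := by
    refine toFinite_absolutelyContinuous μ ?_
    refine measure_mono_null ?_ hcov
    rw [← Set.compl_iUnion]
    refine Set.compl_subset_compl.2 (Set.iUnion_subset fun j => ?_)
    refine Set.subset_iUnion_of_subset (j + 1) ?_
    exact Set.subset_biUnion_of_mem (u := E) (Finset.mem_coe.2 (Finset.self_mem_range_succ j))
  have hanti : Antitone fun n => (S n)ᶜ := fun m n hmn =>
    Set.compl_subset_compl.2 (Set.biUnion_subset_biUnion_left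
      (by simpa using hmn))
  have hlim := tendsto_measure_iInter_atTop (μ := μ.toFinite)
    (fun n => (hSm n).compl.nullMeasurableSet) hanti ⟨0, measure_ne_top _ _⟩
  rw [hzero] at hlim
  have hlim' := (ENNReal.tendsto_toReal ENNReal.zero_ne_top).comp hlim
  have := ge_of_tendsto' hlim' hle
  simpa using this

/-- No bound on the `g j` is needed: the terms are dominated by the measures of disjoint sets. -/
theorem summable_chiD {E : ℕ → Set X} (hE : ∀ j, MeasurableSet (E j))
    (hd : Pairwise (Function.onFun Disjoint E)) (g : ℕ → sobolev μ) :
    Summable fun j => chiD μ (E j) (g j) :=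
  Summable.of_norm_bounded (g := fun j => μ.toFinite.real (E j)) (summable_measure_toReal hE hd)
    fun j => norm_chiD_le_measure (hE j) (g j)

/-- `ω` is locally the differential of `f`: on each set `Eⱼ` of a countable measurable cover of
almost all of `X`, the function `f` is equal to a Sobolev function `gⱼ` and `ω` to `dgⱼ`. -/
def IsLocalDifferential (μ : Measure X) [SFinite μ] (f : X → ℝ) (ω : CotangentL0 μ) : Prop :=
  ∃ (E : ℕ → Set X) (g : ℕ → sobolev μ), (∀ j, MeasurableSet (E j)) ∧ μ (⋃ j, E j)ᶜ = 0 ∧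
    (∀ j, ∀ᵐ x ∂μ, x ∈ E j → f x = (g j : Lp ℝ 2 μ) x) ∧
    ∀ j, res μ (E j) ω = chiD μ (E j) (g j)

theorem IsLocalDifferential.congr {f f' : X → ℝ} {ω : CotangentL0 μ}
    (h : IsLocalDifferential μ f ω) (hff' : f =ᵐ[μ] f') : IsLocalDifferential μ f' ω := by
  obtain ⟨E, g, hE, hcov, hf, hω⟩ := h
  refine ⟨E, g, hE, hcov, fun j => ?_, hω⟩
  filter_upwards [hf j, hff'] with x h1 h2 hx
  rw [← h2, h1 hx]

theorem IsLocalDifferential.zero : IsLocalDifferential μ (fun _ => 0) 0 := by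
  refine ⟨fun _ => Set.univ, 0, fun _ => MeasurableSet.univ,
    by rw [Set.iUnion_const, Set.compl_univ, measure_empty], fun j => ?_, fun j => ?_⟩
  · filter_upwards [Lp.coeFn_zero ℝ 2 μ] with x hx _
    exact hx.symm
  · have h := chiD_sub (μ := μ) Set.univ 0 0
    rw [sub_self, sub_self] at h
    rw [map_zero]
    exact h.symm

/-- Both covers are replaced by their common refinement, indexed through `Nat.pair`. -/
theorem IsLocalDifferential.add {f f' : X → ℝ} {ω ω' : CotangentL0 μ}
    (h : IsLocalDifferential μ f ω) (h' : IsLocalDifferential μ f' ω') :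
    IsLocalDifferential μ (fun x => f x + f' x) (ω + ω') := by
  obtain ⟨E, g, hE, hcov, hf, hω⟩ := h
  obtain ⟨E', g', hE', hcov', hf', hω'⟩ := h'
  refine ⟨fun n => E n.unpair.1 ∩ E' n.unpair.2, fun n => g n.unpair.1 + g' n.unpair.2,
    fun n => (hE _).inter (hE' _), ?_, fun n => ?_, fun n => ?_⟩
  · refine measure_mono_null ?_ (measure_union_null hcov hcov')
    rw [← Set.compl_inter, Set.compl_subset_compl]
    rintro x ⟨hx, hx'⟩
    obtain ⟨i, hi⟩ := Set.mem_iUnion.1 hx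
    obtain ⟨j, hj⟩ := Set.mem_iUnion.1 hx'
    exact Set.mem_iUnion.2 ⟨Nat.pair i j, by simpa using ⟨hi, hj⟩⟩
  · filter_upwards [hf n.unpair.1, hf' n.unpair.2,
      Lp.coeFn_add (g n.unpair.1 : Lp ℝ 2 μ) (g' n.unpair.2 : Lp ℝ 2 μ)] with x h1 h2 h3 hx
    rw [h1 hx.1, h2 hx.2]
    exact h3.symm
  · rw [map_add, chiD_add]
    congr 1
    · beta_reduce
      rw [Set.inter_comm, ← res_res (hE' _) (hE _), hω, res_chiD (hE' _) (hE _)]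
    · beta_reduce
      rw [← res_res (hE _) (hE' _), hω', res_chiD (hE _) (hE' _)]

/-- Restriction to `E j` is continuous, so it may be applied termwise to the series; disjointness
kills all terms but one. -/
theorem HasDifferential.isLocalDifferential {f : X → ℝ} {ω : CotangentL0 μ}
    (h : HasDifferential μ f ω) : IsLocalDifferential μ f ω := by
  obtain ⟨E, g, v, hE, hd, hcov, -, hgv, hfv, hsum⟩ := h
  refine ⟨E, g, hE, hcov, fun j => ?_, fun j => ?_⟩
  · filter_upwards [hgv j, hfv j] with x h1 h2 hx
    rw [h1, h2 hx]
  · have h1 := hsum.map (res μ (E j)) (continuous_res _)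
    refine h1.unique ?_
    have h2 := hasSum_single (f := res μ (E j) ∘ fun i => chiD μ (E i) (g i)) j fun i hi => by
      rw [Function.comp_apply, res_chiD (hE j) (hE i), (hd hi.symm).inter_eq, chiD_empty]
    rwa [Function.comp_apply, res_chiD (hE j) (hE j), Set.inter_self] at h2

section Smul

variable [BorelSpace X]

/-- The truncated norm is not homogeneous, whence the factor `max 1 |c|`. For `|c| ≤ 1` this is a
contraction, which is all that convex combinations require. -/
theorem SimpleForm.norm_smul_le (c : ℝ) (s : SimpleForm μ) : ‖c • s‖ ≤ max 1 |c| * ‖s‖ := by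
  rw [norm_eq, norm_eq, ← integral_const_mul]
  refine integral_mono_ae (c • s).integrable_min (s.integrable_min.const_mul _) ?_
  have h1 := s.pointwiseNorm_smul_le c
  have h2 := s.pointwiseNorm_nonneg
  rw [← ae_toFinite] at h1 h2
  filter_upwards [h1, h2] with x a b
  rcases le_total 1 (s.pointwiseNorm x) with h | h
  · rw [min_eq_left h, mul_one]
    exact (min_le_left _ _).trans (le_max_left _ _)
  · rw [min_eq_right h]
    exact (min_le_right _ _).trans (a.trans (mul_le_mul_of_nonneg_right (le_max_right _ _) b))

instance SimpleForm.uniformContinuousConstSMul : UniformContinuousConstSMul ℝ (SimpleForm μ) where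
  uniformContinuous_const_smul c := uniformContinuous_of_continuousAt_zero
    (DistribSMul.toAddMonoidHom (SimpleForm μ) c)
    (AddMonoidHomClass.continuous_of_bound (DistribSMul.toAddMonoidHom (SimpleForm μ) c)
      (max 1 |c|) (fun s => SimpleForm.norm_smul_le c s)).continuousAt

theorem norm_smul_le_of_abs_le_one {c : ℝ} (hc : |c| ≤ 1) (η : CotangentL0 μ) :
    ‖c • η‖ ≤ ‖η‖ := by
  induction η using UniformSpace.Completion.induction_on with
  | hp => exact isClosed_le (continuous_const_smul c).norm continuous_norm
  | ih s =>
    rw [← UniformSpace.Completion.coe_smul, UniformSpace.Completion.norm_coe,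
      UniformSpace.Completion.norm_coe]
    simpa [max_eq_left hc] using SimpleForm.norm_smul_le c s

theorem res_smul {E : Set X} (hE : MeasurableSet E) (c : ℝ) (η : CotangentL0 μ) :
    res μ E (c • η) = c • res μ E η := by
  induction η using UniformSpace.Completion.induction_on with
  | hp =>
    exact isClosed_eq ((continuous_res E).comp (continuous_const_smul c))
      ((continuous_res E).const_smul c)
  | ih s =>
    rw [← UniformSpace.Completion.coe_smul, res_coe, res_coe, ← UniformSpace.Completion.coe_smul]
    congr 1
    apply SimpleFunc.ext
    intro x
    change SimpleFunc.toFun (SimpleForm.restrictHom μ E (c • s)) x =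
      c • SimpleFunc.toFun (SimpleForm.restrictHom μ E s) x
    rw [SimpleForm.restrictHom_apply hE, SimpleForm.restrictHom_apply hE]
    exact Set.indicator_const_smul_apply E c _ x

theorem chiD_smul {E : Set X} (hE : MeasurableSet E) (c : ℝ) (g : sobolev μ) :
    chiD μ E (c • g) = c • chiD μ E g := by
  rw [chiD_eq_coe, chiD_eq_coe, ← res_coe, ← res_coe, ← res_smul hE,
    ← UniformSpace.Completion.coe_smul]
  rfl

/-- Locality of the differential. -/
theorem chiD_congr {E : Set X} (hE : MeasurableSet E) {g h : sobolev μ}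
    (hgh : ∀ᵐ x ∂μ, x ∈ E → (g : Lp ℝ 2 μ) x = (h : Lp ℝ 2 μ) x) :
    chiD μ E g = chiD μ E h := by
  rw [← sub_eq_zero, ← chiD_sub, ← norm_eq_zero, chiD_eq_coe, UniformSpace.Completion.norm_coe,
    SimpleForm.norm_eq]
  refine integral_eq_zero_of_ae ?_
  have h1 := SimpleForm.pointwiseNorm_restrictHom hE (SimpleForm.const (g - h))
  have h2 := minSlope_eq_zero_of_eq hgh
  rw [← ae_toFinite] at h1 h2
  filter_upwards [h1, h2] with x a b
  rw [a]
  by_cases hx : x ∈ E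
  · rw [Set.indicator_of_mem hx]
    change min 1 (minSlope (g - h) x) = 0
    rw [b hx]
    exact min_eq_right zero_le_one
  · simp [hx]

/-- On `A ∩ E j` the Sobolev function `g` and the local representative both equal `f`, so their
differentials agree there by locality; the `E j` cover almost everything. -/
theorem IsLocalDifferential.res_eq {f : X → ℝ} {ω : CotangentL0 μ}
    (h : IsLocalDifferential μ f ω) {A : Set X} (hA : MeasurableSet A) {g : sobolev μ}
    (hg : ∀ᵐ x ∂μ, x ∈ A → f x = (g : Lp ℝ 2 μ) x) : res μ A ω = chiD μ A g := by
  obtain ⟨E, g', hE, hcov, hf, hω⟩ := h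
  rw [← sub_eq_zero]
  refine eq_zero_of_forall_res_eq_zero hE hcov fun j => ?_
  rw [map_sub, res_res (hE j) hA, Set.inter_comm, ← res_res hA (hE j), hω j,
    res_chiD hA (hE j), res_chiD (hE j) hA, Set.inter_comm, sub_eq_zero]
  refine chiD_congr ((hE j).inter hA) ?_
  filter_upwards [hf j, hg] with x h1 h2 hx
  rw [← h1 hx.1, ← h2 hx.2]

theorem IsLocalDifferential.unique {f : X → ℝ} {ω ω' : CotangentL0 μ}
    (h : IsLocalDifferential μ f ω) (h' : IsLocalDifferential μ f ω') : ω = ω' := by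
  obtain ⟨E, g', hE, hcov, hf, hω⟩ := h'
  rw [← sub_eq_zero]
  refine eq_zero_of_forall_res_eq_zero hE hcov fun j => ?_
  rw [map_sub, h.res_eq (hE j) (hf j), hω j, sub_self]

theorem IsLocalDifferential.smul {f : X → ℝ} {ω : CotangentL0 μ}
    (h : IsLocalDifferential μ f ω) (c : ℝ) : IsLocalDifferential μ (fun x => c * f x) (c • ω) := by
  obtain ⟨E, g, hE, hcov, hf, hω⟩ := h
  refine ⟨E, fun j => c • g j, hE, hcov, fun j => ?_, fun j => ?_⟩
  · filter_upwards [hf j, Lp.coeFn_smul c (g j : Lp ℝ 2 μ)] with x h1 h2 hx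
    rw [h1 hx]
    exact h2.symm
  · rw [res_smul (hE j), hω j, chiD_smul (hE j)]

theorem IsLocalDifferential.sum {ι : Type*} (s : Finset ι) (c : ι → ℝ) {f : ι → X → ℝ}
    {ω : ι → CotangentL0 μ} (h : ∀ i, IsLocalDifferential μ (f i) (ω i)) :
    IsLocalDifferential μ (fun x => ∑ i ∈ s, c i * f i x) (∑ i ∈ s, c i • ω i) := by
  classical
  induction s using Finset.induction_on with
  | empty => simpa using IsLocalDifferential.zero
  | insert a s ha ih =>
    simp only [Finset.sum_insert ha]
    exact ((h a).smul (c a)).add ih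

theorem HasDifferential.differential_eq {f : X → ℝ} {ω : CotangentL0 μ}
    (h : HasDifferential μ f ω) : differential μ f = ω := by
  have hex : ∃ ω, HasDifferential μ f ω := ⟨ω, h⟩
  rw [differential, dif_pos hex]
  exact hex.choose_spec.isLocalDifferential.unique h.isLocalDifferential

/-- Local representatives obtained as Sobolev limits need not be Lipschitz. Uniqueness allows the
Lipschitz representation to be borrowed from any differential already known to exist. -/
theorem IsLocalDifferential.hasDifferential {f : X → ℝ} {ω : CotangentL0 μ}
    (h : IsLocalDifferential μ f ω) (h' : ∃ ω', HasDifferential μ f ω') :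
    HasDifferential μ f ω := by
  obtain ⟨ω', hω'⟩ := h'
  rwa [h.unique hω'.isLocalDifferential]

end Smul

end LocalDifferential

/-! ### Mazur's argument from a parallelogram identity. -/

section ConvexCombinations

/-- The infima `d n` of `q` over the shrinking sets increase to a finite limit. For near-minimisers
with `m, n ≥ N` the midpoint lies in `C N`, so the parallelogram identity gives `q (w m - w n) ≤ 2 q
(w m) + 2 q (w n) - 4 d N`. The function `q` need not be definite. -/
theorem exists_cauchy_of_antitone_convex {W : Type*} [AddCommGroup W] [Module ℝ W] {q : W → ℝ}
    (hq : ∀ w, 0 ≤ q w) (hpar : ∀ x y, q (x + y) + q (x - y) = 2 * q x + 2 * q y)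
    {C : ℕ → Set W} (hC : ∀ n, Convex ℝ (C n)) (hanti : Antitone C) {M : ℝ}
    (hM : ∀ n, ∃ w ∈ C n, q w ≤ M) :
    ∃ w : ℕ → W, (∀ n, w n ∈ C n) ∧
      ∀ ε > 0, ∃ N, ∀ m ≥ N, ∀ n ≥ N, q (w m - w n) ≤ ε := by
  set d : ℕ → ℝ := fun n => sInf (q '' C n) with hd
  have hbdd : ∀ n, BddBelow (q '' C n) := fun n => ⟨0, by rintro _ ⟨w, -, rfl⟩; exact hq w⟩
  have hne : ∀ n, (q '' C n).Nonempty := fun n => by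
    obtain ⟨w, hw, -⟩ := hM n
    exact ⟨q w, w, hw, rfl⟩
  have hdle : ∀ n, ∀ w ∈ C n, d n ≤ q w := fun n w hw => csInf_le (hbdd n) ⟨w, hw, rfl⟩
  have hmono : Monotone d := fun m n hmn =>
    csInf_le_csInf (hbdd m) (hne n) (Set.image_mono (hanti hmn))
  have hdM : ∀ n, d n ≤ M := fun n => by
    obtain ⟨w, hw, hwM⟩ := hM n
    exact (hdle n w hw).trans hwM
  have hlim := tendsto_atTop_ciSup hmono ⟨M, by rintro _ ⟨n, rfl⟩; exact hdM n⟩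
  have hsup : ∀ n, d n ≤ ⨆ i, d i := fun n =>
    le_ciSup ⟨M, by rintro _ ⟨n, rfl⟩; exact hdM n⟩ n
  have hex : ∀ n : ℕ, ∃ w ∈ C n, q w < d n + 1 / ((n : ℝ) + 1) := fun n => by
    have hpos : (0 : ℝ) < 1 / ((n : ℝ) + 1) := by positivity
    obtain ⟨_, ⟨w, hw, rfl⟩, hlt⟩ := exists_lt_of_csInf_lt (hne n) (lt_add_of_pos_right (d n) hpos)
    exact ⟨w, hw, hlt⟩
  choose w hw hqw using hex
  refine ⟨w, hw, fun ε hε => ?_⟩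
  -- The final estimate uses four copies of the gap below the supremum and four of the
  -- near-minimising error, hence `ε / 8` for each.
  have h1 : ∀ᶠ N in atTop, (⨆ i, d i) - ε / 8 < d N :=
    hlim.eventually_const_lt (by linarith)
  have h2 : ∀ᶠ N : ℕ in atTop, 1 / ((N : ℝ) + 1) < ε / 8 :=
    tendsto_one_div_add_atTop_nhds_zero_nat.eventually_lt_const (by positivity)
  obtain ⟨N, hN1, hN2⟩ := (h1.and h2).exists
  have hq0 : q 0 = 0 := by
    have := hpar 0 0
    simp only [add_zero, sub_zero] at this
    linarith
  refine ⟨N, fun m hm n hn => ?_⟩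
  have hinv : ∀ k ≥ N, 1 / ((k : ℝ) + 1) ≤ 1 / ((N : ℝ) + 1) := fun k hk =>
    one_div_le_one_div_of_le (by positivity) (by exact_mod_cast Nat.succ_le_succ hk)
  have hmid : (1 / 2 : ℝ) • w m + (1 / 2 : ℝ) • w n ∈ C N :=
    hC N (hanti hm (hw m)) (hanti hn (hw n)) (by norm_num) (by norm_num) (by norm_num)
  have h3 := hdle N _ hmid
  -- The identity with both arguments equal to the midpoint gives `q (w m + w n) = 4 q (midpoint)`,
  -- so homogeneity of `q` need not be assumed.
  have h4 := hpar ((1 / 2 : ℝ) • w m + (1 / 2 : ℝ) • w n) ((1 / 2 : ℝ) • w m + (1 / 2 : ℝ) • w n)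
  have h5 : ((1 / 2 : ℝ) • w m + (1 / 2 : ℝ) • w n) + ((1 / 2 : ℝ) • w m + (1 / 2 : ℝ) • w n) =
      w m + w n := by module
  rw [h5, sub_self, hq0] at h4
  have h6 := hpar (w m) (w n)
  linarith [hqw m, hqw n, hinv m hm, hinv n hn, hsup m, hsup n]

/-- The weights of the convex combinations of the terms of index at least `n`. -/
def tailWeights (n : ℕ) : Set (ℕ →₀ ℝ) :=
  {a | (∀ i, 0 ≤ a i) ∧ (∀ i < n, a i = 0) ∧
    Finsupp.linearCombination ℝ (fun _ : ℕ => (1 : ℝ)) a = 1}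

theorem convex_tailWeights (n : ℕ) : Convex ℝ (tailWeights n) := by
  rintro a ⟨ha0, ha1, ha2⟩ b ⟨hb0, hb1, hb2⟩ s t hs ht hst
  refine ⟨fun i => ?_, fun i hi => ?_, ?_⟩
  · simp only [Finsupp.add_apply, Finsupp.smul_apply, smul_eq_mul]
    exact add_nonneg (mul_nonneg hs (ha0 i)) (mul_nonneg ht (hb0 i))
  · simp [ha1 i hi, hb1 i hi]
  · rw [map_add, map_smul, map_smul, ha2, hb2, smul_eq_mul, smul_eq_mul, mul_one, mul_one, hst]

theorem antitone_tailWeights : Antitone tailWeights := fun _ _ hmn _ ha =>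
  ⟨ha.1, fun i hi => ha.2.1 i (hi.trans_le hmn), ha.2.2⟩

theorem single_mem_tailWeights (n : ℕ) : Finsupp.single n 1 ∈ tailWeights n := by
  refine ⟨fun i => ?_, fun i hi => ?_, ?_⟩
  · rw [Finsupp.single_apply]
    split_ifs <;> norm_num
  · rw [Finsupp.single_eq_of_ne hi.ne]
  · simp

theorem le_one_of_mem_tailWeights {n : ℕ} {a : ℕ →₀ ℝ} (ha : a ∈ tailWeights n) (i : ℕ) :
    a i ≤ 1 := by
  obtain ⟨h0, -, h2⟩ := ha
  rw [Finsupp.linearCombination_apply, Finsupp.sum] at h2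
  simp only [smul_eq_mul, mul_one] at h2
  by_cases hi : i ∈ a.support
  · rw [← h2]
    exact Finset.single_le_sum (fun j _ => h0 j) hi
  · rw [Finsupp.notMem_support_iff.1 hi]
    exact zero_le_one

/-- The minimisation runs over weights rather than vectors, so that the weights found for one
sequence can be applied to others at the same time. -/
theorem exists_tailWeights_cauchy {V : Type*} [AddCommGroup V] [Module ℝ V] {q : V → ℝ}
    (hq : ∀ w, 0 ≤ q w) (hpar : ∀ x y, q (x + y) + q (x - y) = 2 * q x + 2 * q y)
    {x : ℕ → V} {M : ℝ} (hM : ∀ n, q (x n) ≤ M) :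
    ∃ a : ℕ → ℕ →₀ ℝ, (∀ n, a n ∈ tailWeights n) ∧ ∀ ε > 0, ∃ N, ∀ m ≥ N, ∀ n ≥ N,
      q (Finsupp.linearCombination ℝ x (a m) - Finsupp.linearCombination ℝ x (a n)) ≤ ε := by
  obtain ⟨a, ha, hc⟩ := exists_cauchy_of_antitone_convex
    (q := fun a : ℕ →₀ ℝ => q (Finsupp.linearCombination ℝ x a)) (fun _ => hq _)
    (fun a b => by rw [map_add, map_sub, hpar]) convex_tailWeights antitone_tailWeights
    (M := M) (fun n => ⟨_, single_mem_tailWeights n, by simpa using hM n⟩)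
  exact ⟨a, ha, by simpa only [map_sub] using hc⟩

/-- Convex combinations of tails of a summably convergent sequence converge, without local
convexity. -/
theorem tendsto_linearCombination_of_summable {V : Type*} [SeminormedAddCommGroup V] [Module ℝ V]
    (hs : ∀ (c : ℝ) (y : V), |c| ≤ 1 → ‖c • y‖ ≤ ‖y‖) {x : ℕ → V} {x₀ : V}
    (hx : Summable fun n => ‖x n - x₀‖) {a : ℕ → ℕ →₀ ℝ} (ha : ∀ n, a n ∈ tailWeights n) :
    Tendsto (fun n => Finsupp.linearCombination ℝ x (a n)) atTop (𝓝 x₀) := by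
  rw [tendsto_iff_norm_sub_tendsto_zero, Metric.tendsto_atTop]
  intro ε hε
  obtain ⟨s, hsum⟩ := summable_iff_vanishing_norm.1 hx ε hε
  refine ⟨s.sup id + 1, fun n hn => ?_⟩
  have hdisj : Disjoint (a n).support s := by
    rw [Finset.disjoint_left]
    intro i hi his
    refine Finsupp.mem_support_iff.1 hi ((ha n).2.1 i ?_)
    exact (Nat.lt_succ_of_le (Finset.le_sup (f := id) his)).trans_le hn
  have h1 := hsum _ hdisj
  have h2 : Finsupp.linearCombination ℝ x (a n) - x₀ =
      ∑ i ∈ (a n).support, a n i • (x i - x₀) := by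
    have h3 := (ha n).2.2
    rw [Finsupp.linearCombination_apply, Finsupp.sum] at h3
    simp only [smul_eq_mul, mul_one] at h3
    simp only [smul_sub, Finset.sum_sub_distrib, ← Finset.sum_smul, h3, one_smul]
    rfl
  rw [Real.dist_eq, sub_zero, abs_norm, h2]
  refine lt_of_le_of_lt ?_ ((le_abs_self _).trans_lt h1)
  refine norm_sum_le_of_le _ fun i _ => hs _ _ ?_
  rw [abs_of_nonneg ((ha n).1 i)]
  exact le_one_of_mem_tailWeights (ha n) i

theorem norm_smul_le_of_abs_le_one_of_normedSpace {V : Type*} [SeminormedAddCommGroup V]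
    [NormedSpace ℝ V] (c : ℝ) (y : V) (hc : |c| ≤ 1) : ‖c • y‖ ≤ ‖y‖ := by
  rw [norm_smul]
  exact mul_le_of_le_one_left (norm_nonneg _) hc

theorem exists_subseq_summable {V : Type*} [SeminormedAddCommGroup V] {x : ℕ → V} {x₀ : V}
    (hx : Tendsto x atTop (𝓝 x₀)) :
    ∃ ns : ℕ → ℕ, StrictMono ns ∧ Summable fun n => ‖x (ns n) - x₀‖ := by
  have h : ∀ n : ℕ, ∀ᶠ k in atTop, ‖x k - x₀‖ ≤ (1 / 2 : ℝ) ^ n := fun n =>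
    (tendsto_iff_norm_sub_tendsto_zero.1 hx).eventually_le_const (by positivity)
  obtain ⟨ns, hns, hle⟩ := extraction_forall_of_eventually h
  exact ⟨ns, hns, Summable.of_nonneg_of_le (fun _ => norm_nonneg _) hle summable_geometric_two⟩

theorem coeFn_sum_smul {X ι : Type*} [MeasurableSpace X] {μ : Measure X} (s : Finset ι)
    (c : ι → ℝ) (u : ι → Lp ℝ 2 μ) :
    (∑ i ∈ s, c i • u i : Lp ℝ 2 μ) =ᵐ[μ] fun x => ∑ i ∈ s, c i * u i x := by
  classical
  induction s using Finset.induction_on with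
  | empty =>
    simp only [Finset.sum_empty]
    exact Lp.coeFn_zero ℝ 2 μ
  | insert a s ha ih =>
    simp only [Finset.sum_insert ha]
    filter_upwards [ih, Lp.coeFn_add (c a • u a) (∑ i ∈ s, c i • u i),
      Lp.coeFn_smul (c a) (u a)] with x h1 h2 h3
    rw [h2, Pi.add_apply, h1, h3, Pi.smul_apply, smul_eq_mul]

end ConvexCombinations

/-! ### Strong limits and extensions in `W^{1,2}`. -/

section Sobolev

variable {X : Type*} [MetricSpace X] [MeasurableSpace X] {μ : Measure X}

theorem coe_linearCombination_sobolev (g : ℕ → sobolev μ) (a : ℕ →₀ ℝ) :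
    ((Finsupp.linearCombination ℝ g a : sobolev μ) : Lp ℝ 2 μ) =
      Finsupp.linearCombination ℝ (fun n => (g n : Lp ℝ 2 μ)) a := by
  rw [← Submodule.subtype_apply, Finsupp.apply_linearCombination]
  rfl

/-- Along subsequences the slopes tend to zero almost everywhere, and `min 1` of them is dominated
by 1 for the finite measure. -/
theorem tendsto_chiD [SFinite μ] (E : Set X) {g : ℕ → sobolev μ} {g₀ : sobolev μ}
    (h : Tendsto (fun n => ‖minSlope (g n - g₀)‖) atTop (𝓝 0)) :
    Tendsto (fun n => chiD μ E (g n)) atTop (𝓝 (chiD μ E g₀)) := by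
  rw [tendsto_iff_norm_sub_tendsto_zero]
  simp only [← chiD_sub]
  refine squeeze_zero (fun _ => norm_nonneg _) (fun n => norm_chiD_le_integral E _) ?_
  refine tendsto_of_subseq_tendsto fun ns hns => ?_
  have h0 : Tendsto (fun n => minSlope (g (ns n) - g₀)) atTop (𝓝 0) :=
    tendsto_zero_iff_norm_tendsto_zero.2 (h.comp hns)
  obtain ⟨ms, -, hae⟩ := (tendstoInMeasure_of_tendsto_Lp h0).exists_seq_tendsto_ae
  refine ⟨ms, ?_⟩
  have := tendsto_integral_of_dominated_convergence (μ := μ.toFinite)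
    (F := fun n x => min 1 (minSlope (g (ns (ms n)) - g₀) x)) (f := fun _ => (0 : ℝ))
    (fun _ => 1) (fun n => (measurable_const.min
      (Lp.stronglyMeasurable _).measurable).aestronglyMeasurable) (integrable_const _) ?_ ?_
  · simpa using this
  · intro n
    have hn := (Lp.coeFn_nonneg _).2 (minSlope_nonneg (g (ns (ms n)) - g₀))
    rw [Filter.EventuallyLE, ← ae_toFinite] at hn
    filter_upwards [hn] with x hx
    rw [Real.norm_of_nonneg (le_min zero_le_one hx)]
    exact min_le_left _ _
  · have hz := Lp.coeFn_zero ℝ 2 μ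
    rw [Filter.EventuallyEq, ← ae_toFinite] at hz
    rw [← ae_toFinite] at hae
    filter_upwards [hae, hz] with x hx hx0
    rw [hx0] at hx
    simpa using (tendsto_const_nhds (x := (1 : ℝ))).min hx

variable [BorelSpace X]

/-- Bounded sequences in the Sobolev space have convex combinations that converge. -/
theorem exists_tailWeights_tendsto_sobolev (hX : InfinitesimallyHilbertian μ) {g : ℕ → sobolev μ}
    {M : ℝ} (hM : ∀ n, ‖g n‖ ^ 2 + ‖minSlope (g n)‖ ^ 2 ≤ M) :
    ∃ (a : ℕ → ℕ →₀ ℝ) (g₀ : sobolev μ), (∀ n, a n ∈ tailWeights n) ∧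
      Tendsto (fun n => ((Finsupp.linearCombination ℝ g (a n) : sobolev μ) : Lp ℝ 2 μ)) atTop
        (𝓝 (g₀ : Lp ℝ 2 μ)) ∧
      Tendsto (fun n => ‖minSlope (Finsupp.linearCombination ℝ g (a n) - g₀)‖) atTop (𝓝 0) := by
  obtain ⟨a, ha, hc⟩ := exists_tailWeights_cauchy (V := sobolev μ)
    (q := fun g => ‖g‖ ^ 2 + ‖minSlope g‖ ^ 2) (fun _ => by positivity)
    (fun f g => (hX f g).trans (by ring)) hM
  obtain ⟨g₀, h1, h2⟩ := exists_tendsto_of_cauchy_sobolev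
    (g := fun n => Finsupp.linearCombination ℝ g (a n)) fun ε hε => by
      obtain ⟨N, hN⟩ := hc (ε ^ 2) (by positivity)
      refine ⟨N, fun m hm n hn => ?_⟩
      have := hN m hm n hn
      constructor
      · exact le_of_sq_le_sq (by nlinarith [sq_nonneg ‖minSlope (Finsupp.linearCombination ℝ g (a m)
          - Finsupp.linearCombination ℝ g (a n))‖]) hε.le
      · exact le_of_sq_le_sq (by nlinarith [sq_nonneg ‖Finsupp.linearCombination ℝ g (a m)
          - Finsupp.linearCombination ℝ g (a n)‖]) hε.le
  exact ⟨a, g₀, ha, h1, h2⟩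

/-- A bounded Lipschitz function on a bounded set extends to a Lipschitz function with bounded
support, with a bound on the Sobolev norm that depends only on the set and the constants. -/
theorem exists_sobolev_extension [IsFiniteOnBalls μ] {A : Set X} {R : ℝ} (hR : 0 < R)
    (hA : ∀ x ∈ A, ∀ y ∈ A, dist x y ≤ R) (L k : ℝ≥0) :
    ∃ M : ℝ, ∀ f : X → ℝ, LipschitzOnWith L f A → (∀ x ∈ A, |f x| ≤ k) →
      ∃ (g : sobolev μ) (v : X → ℝ), IsLipBS v ∧ g =ᵐ[μ] v ∧ Set.EqOn f v A ∧
        ‖g‖ ^ 2 + ‖minSlope g‖ ^ 2 ≤ M := by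
  rcases A.eq_empty_or_nonempty with rfl | ⟨x₀, hx₀⟩
  · refine ⟨0, fun f _ _ => ⟨0, fun _ => 0, IsLipBS.zero, Lp.coeFn_zero ℝ 2 μ,
      Set.eqOn_empty _ _, ?_⟩⟩
    rw [minSlope_zero]
    simp
  set B := Metric.closedBall x₀ (2 * R) with hB
  have hBm : MeasurableSet B := Metric.isClosed_closedBall.measurableSet
  have hBfin : μ B ≠ ∞ := by
    refine ((measure_mono ?_).trans_lt (IsFiniteOnBalls.measure_ball_lt_top x₀ (3 * R))).ne
    exact Metric.closedBall_subset_ball (by linarith)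
  set K : ℝ≥0 := max L (k / R.toNNReal) with hK
  set Hk : Lp ℝ 2 μ := indicatorConstLp 2 hBm hBfin (k : ℝ) with hHk
  set HK : Lp ℝ 2 μ := indicatorConstLp 2 hBm hBfin (K : ℝ) with hHK
  refine ⟨‖Hk‖ ^ 2 + ‖HK‖ ^ 2, fun f hf hfk => ?_⟩
  obtain ⟨e, he, hfe⟩ := hf.extend_real
  set h : X → ℝ := fun x => max 0 (min (k : ℝ) (2 * k - k / R * dist x x₀)) with hh
  have hcoe : ((k / R.toNNReal : ℝ≥0) : ℝ) = k / R := by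
    rw [NNReal.coe_div, Real.coe_toNNReal R hR.le]
  have hhL : LipschitzWith (k / R.toNNReal) h := by
    refine LipschitzWith.const_max (LipschitzWith.const_min ?_ _) _
    refine LipschitzWith.of_dist_le_mul fun x y => ?_
    rw [hcoe, Real.dist_eq, sub_sub_sub_cancel_left, ← mul_sub, abs_mul,
      abs_of_nonneg (by positivity)]
    refine mul_le_mul_of_nonneg_left ?_ (by positivity)
    rw [abs_sub_comm]
    exact abs_dist_sub_le x y x₀
  have hh0 : ∀ x, 0 ≤ h x := fun x => le_max_left _ _
  have hhk : ∀ x, h x ≤ k := fun x => max_le k.coe_nonneg (min_le_left _ _)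
  have hhA : ∀ x ∈ A, h x = k := fun x hx => by
    have h1 := mul_le_mul_of_nonneg_left (hA x hx x₀ hx₀) (by positivity : 0 ≤ (k : ℝ) / R)
    rw [div_mul_cancel₀ _ hR.ne'] at h1
    simp only [hh]
    rw [min_eq_left (by linarith), max_eq_right k.coe_nonneg]
  have hhB : ∀ x ∉ B, h x = 0 := fun x hx => by
    rw [hB, Metric.mem_closedBall, not_le] at hx
    have h1 := mul_le_mul_of_nonneg_left hx.le (by positivity : 0 ≤ (k : ℝ) / R)
    have h2 : (k : ℝ) / R * (2 * R) = 2 * k := by field_simp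
    exact max_eq_left ((min_le_right _ _).trans (by linarith))
  set v : X → ℝ := fun x => max (-h x) (min (h x) (e x)) with hv
  have hvL : LipschitzWith K v := by
    have := hhL.neg.max (hhL.min he)
    refine this.weaken ?_
    rw [max_comm (k / R.toNNReal) L, ← hK]
    exact max_le (le_max_right _ _) le_rfl
  have hvh : ∀ x, |v x| ≤ h x := fun x =>
    abs_le.2 ⟨le_max_left _ _, max_le (by linarith [hh0 x]) (min_le_left _ _)⟩
  have hvB : ∀ x ∉ B, v x = 0 := fun x hx => by
    have := hvh x
    rw [hhB x hx] at this
    exact abs_nonpos_iff.1 this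
  have hvs : IsLipBS v := by
    refine ⟨⟨K, hvL⟩, Metric.isBounded_closedBall.subset (fun x hx => ?_ : _ ⊆ B)⟩
    by_contra hxB
    exact hx (hvB x hxB)
  have hvA : Set.EqOn f v A := fun x hx => by
    have h1 := abs_le.1 (hfk x hx)
    simp only [hv]
    rw [hhA x hx, ← hfe hx, min_eq_right h1.2, max_eq_right h1.1]
  have hvle : ∀ᵐ x ∂μ, ‖v x‖ ≤ ‖Hk x‖ := by
    filter_upwards [indicatorConstLp_coeFn (p := 2) (hs := hBm) (hμs := hBfin) (c := (k : ℝ))]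
      with x hx
    rw [hHk, hx]
    by_cases hxB : x ∈ B
    · rw [Set.indicator_of_mem hxB, Real.norm_eq_abs, Real.norm_of_nonneg k.coe_nonneg]
      exact (hvh x).trans (hhk x)
    · rw [hvB x hxB, norm_zero]
      exact norm_nonneg _
  have hvm : MemLp v 2 μ :=
    (Lp.memLp Hk).of_le hvs.continuous.measurable.aestronglyMeasurable hvle
  have hslope : IsRelaxedSlope μ (hvm.toLp v) HK := by
    refine isRelaxedSlope_of_isLipBS hvs hvm.coeFn_toLp ?_
    filter_upwards [indicatorConstLp_coeFn (p := 2) (hs := hBm) (hμs := hBfin) (c := (K : ℝ))]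
      with x hx
    rw [hHK, hx, hvs.toReal_lipConst_le_iff (Set.indicator_nonneg (fun _ _ => K.coe_nonneg) x)]
    intro ε hε
    by_cases hxB : x ∈ B
    · refine Eventually.of_forall fun y => ?_
      rw [Set.indicator_of_mem hxB, ← Real.dist_eq]
      exact (hvL.dist_le_mul y x).trans
        (mul_le_mul_of_nonneg_right (by linarith) dist_nonneg)
    -- Off the closed ball `v` vanishes in a whole neighbourhood, so its slope is zero there and the
    -- bound `HK` depends only on the ball and the constants.
    · filter_upwards [Metric.isClosed_closedBall.isOpen_compl.mem_nhds hxB] with y hy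
      rw [hvB x hxB, hvB y hy, sub_zero, abs_zero, Set.indicator_of_notMem hxB]
      have := dist_nonneg (x := y) (y := x)
      positivity
  refine ⟨⟨hvm.toLp v, ⟨HK, hslope⟩⟩, v, hvs, hvm.coeFn_toLp, hvA, ?_⟩
  refine add_le_add (pow_le_pow_left₀ (norm_nonneg _) ?_ 2)
    (pow_le_pow_left₀ (norm_nonneg _) (norm_minSlope_le hslope) 2)
  refine Lp.norm_le_norm_of_ae_le (f := hvm.toLp v) ?_
  filter_upwards [hvle, hvm.coeFn_toLp] with x h1 h2
  rwa [h2]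

end Sobolev

/-! ### Admissible functions and Lusin–Lipschitz partitions. -/

section Hajlasz

variable {X : Type*} [MetricSpace X] [MeasurableSpace X] {μ : Measure X} {φ : X →ₘ[μ] ℝ} {R : ℝ}

/-- The inequality concerns pairs of points, so the exceptional set has to come from a condition `p`
on single points. -/
theorem mem_admissible_of_ae {f G : Lp ℝ 2 μ} (hG : 0 ≤ G) {p : X → Prop} (hp : ∀ᵐ x ∂μ, p x)
    (h : ∀ x y, p x → p y → dist x y ≤ R →
      |f x - f y| ≤ Real.exp (φ x + φ y) * (G x + G y) * dist x y) :
    G ∈ admissible φ R f := by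
  obtain ⟨N, hN, hNm, hN0⟩ := exists_measurable_superset_of_null (ae_iff.1 hp)
  have hpN : ∀ x ∉ N, p x := fun x hx => by
    by_contra hx'
    exact hx (hN hx')
  exact ⟨hG, N, hNm, hN0, fun x hx y hy => h x y (hpN x hx) (hpN y hy)⟩

theorem zero_mem_admissible_zero : (0 : Lp ℝ 2 μ) ∈ admissible φ R 0 :=
  mem_admissible_of_ae le_rfl (Lp.coeFn_zero ℝ 2 μ) fun x y hx hy _ => by
    rw [hx, hy]
    simp

theorem add_mem_admissible {f f' G G' : Lp ℝ 2 μ} (h : G ∈ admissible φ R f)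
    (h' : G' ∈ admissible φ R f') : G + G' ∈ admissible φ R (f + f') := by
  obtain ⟨hG, N, -, hN, hf⟩ := h
  obtain ⟨hG', N', -, hN', hf'⟩ := h'
  refine mem_admissible_of_ae (add_nonneg hG hG')
    (((measure_eq_zero_iff_ae_notMem.1 hN).and (measure_eq_zero_iff_ae_notMem.1 hN')).and
      ((Lp.coeFn_add f f').and (Lp.coeFn_add G G'))) ?_
  rintro x y ⟨⟨hx, hx'⟩, hfx, hGx⟩ ⟨⟨hy, hy'⟩, hfy, hGy⟩ hxy
  rw [hfx, hfy, hGx, hGy]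
  simp only [Pi.add_apply]
  rw [add_sub_add_comm]
  refine (abs_add_le _ _).trans ((add_le_add (hf x hx y hy hxy) (hf' x hx' y hy' hxy)).trans_eq ?_)
  ring

theorem smul_mem_admissible {f G : Lp ℝ 2 μ} (h : G ∈ admissible φ R f) {c : ℝ} (hc : 0 ≤ c) :
    c • G ∈ admissible φ R (c • f) := by
  obtain ⟨hG, N, -, hN, hf⟩ := h
  refine mem_admissible_of_ae ?_ ((measure_eq_zero_iff_ae_notMem.1 hN).and
      ((Lp.coeFn_smul c f).and (Lp.coeFn_smul c G))) ?_
  · rw [← Lp.coeFn_nonneg] at hG ⊢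
    filter_upwards [hG, Lp.coeFn_smul c G] with x h1 h2
    rw [h2]
    exact mul_nonneg hc h1
  rintro x y ⟨hx, hfx, hGx⟩ ⟨hy, hfy, hGy⟩ hxy
  rw [hfx, hfy, hGx, hGy]
  simp only [Pi.smul_apply, smul_eq_mul]
  rw [← mul_sub, abs_mul, abs_of_nonneg hc]
  refine (mul_le_mul_of_nonneg_left (hf x hx y hy hxy) hc).trans_eq ?_
  ring

theorem linearCombination_mem_admissible {f G : ℕ → Lp ℝ 2 μ} (h : ∀ n, G n ∈ admissible φ R (f n))
    {a : ℕ →₀ ℝ} (ha : ∀ i, 0 ≤ a i) :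
    Finsupp.linearCombination ℝ G a ∈ admissible φ R (Finsupp.linearCombination ℝ f a) := by
  rw [Finsupp.linearCombination_apply, Finsupp.linearCombination_apply, Finsupp.sum, Finsupp.sum]
  induction a.support using Finset.induction_on with
  | empty => exact zero_mem_admissible_zero
  | insert i s hi ih =>
    rw [Finset.sum_insert hi, Finset.sum_insert hi]
    exact add_mem_admissible (smul_mem_admissible (h i) (ha i)) ih

/-- Admissible functions pass to almost everywhere limits. -/
theorem mem_admissible_of_tendsto {f G : ℕ → Lp ℝ 2 μ} {f₀ G₀ : Lp ℝ 2 μ}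
    (h : ∀ n, G n ∈ admissible φ R (f n))
    (hf : ∀ᵐ x ∂μ, Tendsto (fun n => f n x) atTop (𝓝 (f₀ x)))
    (hG : ∀ᵐ x ∂μ, Tendsto (fun n => G n x) atTop (𝓝 (G₀ x))) :
    G₀ ∈ admissible φ R f₀ := by
  choose hG0 N _ hN hineq using h
  have hN' := ae_all_iff.2 fun n => measure_eq_zero_iff_ae_notMem.1 (hN n)
  refine mem_admissible_of_ae ?_ ((hf.and hG).and hN') ?_
  · rw [← Lp.coeFn_nonneg]
    filter_upwards [hG, ae_all_iff.2 fun n => (Lp.coeFn_nonneg _).2 (hG0 n)] with x h1 h2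
    exact ge_of_tendsto' h1 h2
  · rintro x y ⟨⟨hfx, hGx⟩, hNx⟩ ⟨⟨hfy, hGy⟩, hNy⟩ hxy
    exact le_of_tendsto_of_tendsto' (hfx.sub hfy).abs
      (((hGx.add hGy).const_mul _).mul_const _) fun n => hineq n x (hNx n) y (hNy n) hxy

theorem exists_cover_dist_le [SecondCountableTopology X] [BorelSpace X] (hR : 0 < R) :
    ∃ D : ℕ → Set X, (∀ i, MeasurableSet (D i)) ∧ (⋃ i, D i) = Set.univ ∧
      ∀ i, ∀ x ∈ D i, ∀ y ∈ D i, dist x y ≤ R := by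
  rcases isEmpty_or_nonempty X with hX | hX
  · exact ⟨fun _ => ∅, fun _ => MeasurableSet.empty, Set.eq_univ_of_forall fun x => hX.elim x,
      fun i x hx => hx.elim⟩
  refine ⟨fun i => Metric.ball (TopologicalSpace.denseSeq X i) (R / 2),
    fun i => Metric.isOpen_ball.measurableSet, Set.eq_univ_of_forall fun x => ?_,
    fun i x hx y hy => ?_⟩
  · obtain ⟨i, hi⟩ := Metric.denseRange_iff.1 (TopologicalSpace.denseRange_denseSeq X) x
      (R / 2) (half_pos hR)
    exact Set.mem_iUnion.2 ⟨i, hi⟩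
  · have := dist_triangle_right x y (TopologicalSpace.denseSeq X i)
    rw [Metric.mem_ball] at hx hy
    linarith

/-- Almost all of the space is partitioned into sets on which a sequence of functions, with
pointwise bounded admissible functions, is uniformly bounded and uniformly Lipschitz. -/
theorem exists_lipschitz_partition [SecondCountableTopology X] [BorelSpace X] (hR : 0 < R)
    {f G : ℕ → Lp ℝ 2 μ} (h : ∀ n, G n ∈ admissible φ R (f n))
    (hb : ∀ᵐ x ∂μ, (∃ C : ℝ, ∀ n, |f n x| ≤ C) ∧ ∃ C : ℝ, ∀ n, |G n x| ≤ C) :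
    ∃ (E : ℕ → Set X) (L k : ℕ → ℝ≥0), (∀ j, MeasurableSet (E j)) ∧
      Pairwise (Function.onFun Disjoint E) ∧ μ (⋃ j, E j)ᶜ = 0 ∧
      (∀ j, ∀ x ∈ E j, ∀ y ∈ E j, dist x y ≤ R) ∧
      (∀ j n, LipschitzOnWith (L j) (f n) (E j)) ∧ ∀ j n, ∀ x ∈ E j, |f n x| ≤ k j := by
  obtain ⟨D, hDm, hDcov, hD⟩ := exists_cover_dist_le (X := X) hR
  choose hG0 N hNm hN hineq using h
  -- On `P m` the functions, their admissible `G n` and `φ` are all bounded above by `m`.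
  -- Intersecting with a set of diameter at most `R` makes the admissibility inequality available
  -- for all pairs, with Lipschitz constant `exp (m + m) * (m + m)`.
  set P : ℕ → Set X := fun m => ((⋂ n, {x | |f n x| ≤ m}) ∩ (⋂ n, {x | |G n x| ≤ m})) ∩
    ({x | φ x ≤ m} ∩ ⋂ n, (N n)ᶜ) with hP
  have hPm : ∀ m, MeasurableSet (P m) := fun m =>
    ((MeasurableSet.iInter fun n => measurableSet_le
        (Lp.stronglyMeasurable (f n)).measurable.abs measurable_const).inter
      (MeasurableSet.iInter fun n => measurableSet_le
        (Lp.stronglyMeasurable (G n)).measurable.abs measurable_const)).inter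
      ((measurableSet_le φ.measurable measurable_const).inter
        (MeasurableSet.iInter fun n => (hNm n).compl))
  set A : ℕ → Set X := fun j => P j.unpair.1 ∩ D j.unpair.2 with hA
  have hAm : ∀ j, MeasurableSet (A j) := fun j => (hPm _).inter (hDm _)
  refine ⟨disjointed A, fun j => (Real.exp (j.unpair.1 + j.unpair.1) *
      (j.unpair.1 + j.unpair.1)).toNNReal, fun j => j.unpair.1,
    fun j => MeasurableSet.disjointed hAm j, disjoint_disjointed A, ?_, fun j x hx y hy => ?_,
    fun j n => ?_, fun j n x hx => ?_⟩
  · rw [iUnion_disjointed, ← mem_ae_iff]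
    filter_upwards [hb, ae_all_iff.2 fun n => measure_eq_zero_iff_ae_notMem.1 (hN n)] with x hx hNx
    obtain ⟨⟨C, hC⟩, C', hC'⟩ := hx
    obtain ⟨m, hm⟩ := exists_nat_ge (max (max C C') (φ x))
    obtain ⟨i, hi⟩ := Set.mem_iUnion.1 (hDcov.symm ▸ Set.mem_univ x : x ∈ ⋃ i, D i)
    refine Set.mem_iUnion.2 ⟨Nat.pair m i, ?_⟩
    simp only [hA, hP, Nat.unpair_pair]
    have h1 : C ≤ m := (le_max_left _ _).trans ((le_max_left _ _).trans hm)
    have h2 : C' ≤ m := (le_max_right _ _).trans ((le_max_left _ _).trans hm)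
    exact ⟨⟨⟨Set.mem_iInter.2 fun n => (hC n).trans h1, Set.mem_iInter.2 fun n => (hC' n).trans h2⟩,
      (le_max_right _ _).trans hm, Set.mem_iInter.2 hNx⟩, hi⟩
  · exact hD _ x (disjointed_subset A j hx).2 y (disjointed_subset A j hy).2
  · refine LipschitzOnWith.of_dist_le_mul fun x hx y hy => ?_
    obtain ⟨⟨⟨-, hGx⟩, hφx, hNx⟩, hDx⟩ := disjointed_subset A j hx
    obtain ⟨⟨⟨-, hGy⟩, hφy, hNy⟩, hDy⟩ := disjointed_subset A j hy
    simp only [Set.mem_iInter] at hGx hGy hNx hNy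
    rw [Real.coe_toNNReal _ (by positivity), Real.dist_eq]
    refine (hineq n x (hNx n) y (hNy n) (hD _ x hDx y hDy)).trans ?_
    refine mul_le_mul_of_nonneg_right ?_ dist_nonneg
    refine mul_le_mul_of_nonneg (Real.exp_le_exp.2 (add_le_add hφx hφy))
      (add_le_add ((le_abs_self _).trans (hGx n)) ((le_abs_self _).trans (hGy n)))
      (Real.exp_pos _).le (by positivity)
  · obtain ⟨⟨⟨hfx, -⟩, -⟩, -⟩ := disjointed_subset A j hx
    simp only [Set.mem_iInter] at hfx
    simpa using hfx n

/-- Functions in the weighted Hajłasz-Sobolev space are Lusin-Lipschitz. -/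
theorem exists_hasDifferential [SecondCountableTopology X] [BorelSpace X] [IsFiniteOnBalls μ]
    (hR : 0 < R) {f : Lp ℝ 2 μ} (hf : f ∈ hajlaszSobolev φ R) :
    ∃ ω, HasDifferential μ f ω := by
  obtain ⟨G, hG⟩ := hf
  obtain ⟨E, L, k, hE, hd, hcov, hER, hLip, hk⟩ := exists_lipschitz_partition hR
    (f := fun _ => f) (G := fun _ => G) (fun _ => hG)
    (Eventually.of_forall fun x => ⟨⟨_, fun _ => le_rfl⟩, ⟨_, fun _ => le_rfl⟩⟩)
  have hex : ∀ j, ∃ (g : sobolev μ) (v : X → ℝ), IsLipBS v ∧ g =ᵐ[μ] v ∧ Set.EqOn f v (E j) :=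
    fun j => by
      obtain ⟨M, hM⟩ := exists_sobolev_extension (μ := μ) hR (hER j) (L j) (k j)
      obtain ⟨g, v, h1, h2, h3, -⟩ := hM f (hLip j 0) (hk j 0)
      exact ⟨g, v, h1, h2, h3⟩
  choose g v hv hgv hfv using hex
  exact ⟨_, E, g, v, hE, hd, hcov, hv, hgv,
    fun j => Eventually.of_forall fun x hx => hfv j hx, (summable_chiD hE hd g).hasSum⟩

end Hajlasz

/-! ### The two rounds of convex combinations. -/

section Closure

variable {X : Type*} [MetricSpace X] [MeasurableSpace X] {μ : Measure X} {φ : X →ₘ[μ] ℝ} {R : ℝ}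

theorem exists_admissible_norm_sq_lt {f : Lp ℝ 2 μ} (hf : f ∈ hajlaszSobolev φ R) {C : ℝ}
    (hC : hajlaszNorm φ R f ≤ C) : ∃ G ∈ admissible φ R f, ‖G‖ ^ 2 < C ^ 2 + 1 := by
  have h1 : sInf ((fun G : Lp ℝ 2 μ => ‖G‖ ^ 2) '' admissible φ R f) < C ^ 2 + 1 := by
    have := (Real.sqrt_le_iff.1 hC).2
    nlinarith [sq_nonneg ‖f‖]
  obtain ⟨_, ⟨G, hG, rfl⟩, hlt⟩ := exists_lt_of_csInf_lt (hf.image _) h1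
  exact ⟨G, hG, hlt⟩

variable [SecondCountableTopology X] [BorelSpace X] [IsFiniteOnBalls μ]

theorem IsLocalDifferential.linearCombination {f : ℕ → Lp ℝ 2 μ} {ω : ℕ → CotangentL0 μ}
    (h : ∀ n, IsLocalDifferential μ (f n) (ω n)) (a : ℕ →₀ ℝ) :
    IsLocalDifferential μ (Finsupp.linearCombination ℝ f a : Lp ℝ 2 μ)
      (Finsupp.linearCombination ℝ ω a) :=
  (IsLocalDifferential.sum a.support a h).congr (coeFn_sum_smul a.support a f).symm

/-- A sequence bounded in the weighted Hajłasz-Sobolev space whose differentials converge can be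
replaced by convex combinations with strongly convergent admissible functions. -/
theorem exists_convergent_admissible {f : ℕ → Lp ℝ 2 μ} (hf : ∀ n, f n ∈ hajlaszSobolev φ R)
    {C : ℝ} (hC : ∀ n, hajlaszNorm φ R (f n) ≤ C) {f₀ : Lp ℝ 2 μ}
    (hlim : Tendsto f atTop (𝓝 f₀)) {η : ℕ → CotangentL0 μ} {ω : CotangentL0 μ}
    (hη : ∀ n, IsLocalDifferential μ (f n) (η n)) (hd : Tendsto η atTop (𝓝 ω)) :
    ∃ (F G : ℕ → Lp ℝ 2 μ) (θ : ℕ → CotangentL0 μ) (G₀ : Lp ℝ 2 μ),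
      (∀ n, G n ∈ admissible φ R (F n)) ∧ (∀ n, IsLocalDifferential μ (F n) (θ n)) ∧
      (∀ᵐ x ∂μ, Tendsto (fun n => F n x) atTop (𝓝 (f₀ x))) ∧
      (∀ᵐ x ∂μ, Tendsto (fun n => G n x) atTop (𝓝 (G₀ x))) ∧
      (Summable fun n => ‖F n - f₀‖) ∧ Summable fun n => ‖θ n - ω‖ := by
  choose G hG hGC using fun n => exists_admissible_norm_sq_lt (hf n) (hC n)
  -- Summability is arranged for functions and differentials together, in the product, before any
  -- averaging.
  obtain ⟨ns, -, hsum⟩ := exists_subseq_summable (hlim.prodMk_nhds hd)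
  obtain ⟨a, ha, hc⟩ := exists_tailWeights_cauchy (V := Lp ℝ 2 μ) (q := fun u => ‖u‖ ^ 2)
    (fun _ => by positivity)
    (fun x y => by
      have := parallelogram_law_with_norm ℝ x y
      linarith) (x := fun n => G (ns n)) (fun n => (hGC (ns n)).le)
  have hF := tendsto_linearCombination_of_summable (x := fun n => f (ns n)) (x₀ := f₀)
    norm_smul_le_of_abs_le_one_of_normedSpace
    (hsum.of_nonneg_of_le (fun _ => norm_nonneg _) fun n =>
      norm_fst_le ((f (ns n), η (ns n)) - (f₀, ω))) ha
  have hθ := tendsto_linearCombination_of_summable (x := fun n => η (ns n)) (x₀ := ω)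
    (fun c y hc => norm_smul_le_of_abs_le_one hc y)
    (hsum.of_nonneg_of_le (fun _ => norm_nonneg _) fun n =>
      norm_snd_le ((f (ns n), η (ns n)) - (f₀, ω))) ha
  obtain ⟨G₀, hG₀⟩ := cauchySeq_tendsto_of_complete (u := fun n =>
      Finsupp.linearCombination ℝ (fun n => G (ns n)) (a n)) (by
    rw [Metric.cauchySeq_iff]
    intro ε hε
    obtain ⟨N, hN⟩ := hc ((ε / 2) ^ 2) (by positivity)
    refine ⟨N, fun m hm n hn => ?_⟩
    rw [dist_eq_norm]
    exact (le_of_sq_le_sq (hN m hm n hn) (half_pos hε).le).trans_lt (half_lt_self hε))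
  obtain ⟨n₁, hn₁, hae₁⟩ := (tendstoInMeasure_of_tendsto_Lp hF).exists_seq_tendsto_ae
  obtain ⟨n₂, hn₂, hae₂⟩ := (tendstoInMeasure_of_tendsto_Lp
    (hG₀.comp hn₁.tendsto_atTop)).exists_seq_tendsto_ae
  -- The first two extractions give convergence almost everywhere; this one restores summability,
  -- which the second round of convex combinations needs.
  obtain ⟨n₃, hn₃, hsum'⟩ := exists_subseq_summable
    ((hF.prodMk_nhds hθ).comp (hn₁.comp hn₂).tendsto_atTop)
  refine ⟨fun n => Finsupp.linearCombination ℝ (fun n => f (ns n)) (a (n₁ (n₂ (n₃ n)))),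
    fun n => Finsupp.linearCombination ℝ (fun n => G (ns n)) (a (n₁ (n₂ (n₃ n)))),
    fun n => Finsupp.linearCombination ℝ (fun n => η (ns n)) (a (n₁ (n₂ (n₃ n)))), G₀,
    fun n => linearCombination_mem_admissible (fun n => hG (ns n)) (ha _).1,
    fun n => IsLocalDifferential.linearCombination (fun n => hη (ns n)) _, ?_, ?_, ?_, ?_⟩
  · filter_upwards [hae₁] with x hx
    exact hx.comp (hn₂.comp hn₃).tendsto_atTop
  · filter_upwards [hae₂] with x hx
    exact hx.comp hn₃.tendsto_atTop
  · exact hsum'.of_nonneg_of_le (fun _ => norm_nonneg _) fun n => le_max_left _ _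
  · exact hsum'.of_nonneg_of_le (fun _ => norm_nonneg _) fun n => le_max_right _ _

/-- On a set where the functions of a sequence are uniformly Lipschitz, the limit of the
differentials is the differential of the limit. -/
theorem exists_res_eq_chiD (hX : InfinitesimallyHilbertian μ) (hR : 0 < R) {F : ℕ → Lp ℝ 2 μ}
    {θ : ℕ → CotangentL0 μ} {f₀ : Lp ℝ 2 μ} {ω : CotangentL0 μ}
    (h : ∀ n, IsLocalDifferential μ (F n) (θ n)) (hF : Summable fun n => ‖F n - f₀‖)
    (hθ : Summable fun n => ‖θ n - ω‖) {A : Set X} (hA : MeasurableSet A)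
    (hAR : ∀ x ∈ A, ∀ y ∈ A, dist x y ≤ R) {L k : ℝ≥0} (hL : ∀ n, LipschitzOnWith L (F n) A)
    (hk : ∀ n, ∀ x ∈ A, |F n x| ≤ k) :
    ∃ g : sobolev μ, (∀ᵐ x ∂μ, x ∈ A → f₀ x = (g : Lp ℝ 2 μ) x) ∧ res μ A ω = chiD μ A g := by
  obtain ⟨M, hM⟩ := exists_sobolev_extension (μ := μ) hR hAR L k
  choose g v _ hgv hfv hgM using fun n => hM (F n) (hL n) (hk n)
  -- The weights are dictated by the extensions `g n`; summability of `F` and `θ` ensures that their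
  -- averages with these weights still tend to `f₀` and `ω`.
  obtain ⟨a, g₀, ha, hg₀, hslope⟩ := exists_tailWeights_tendsto_sobolev hX hgM
  have hFlim := tendsto_linearCombination_of_summable
    norm_smul_le_of_abs_le_one_of_normedSpace hF ha
  have hθlim := tendsto_linearCombination_of_summable
    (fun c y hc => norm_smul_le_of_abs_le_one hc y) hθ ha
  have heq : ∀ n, ∀ᵐ x ∂μ, x ∈ A → (Finsupp.linearCombination ℝ F (a n) : Lp ℝ 2 μ) x =
      ((Finsupp.linearCombination ℝ g (a n) : sobolev μ) : Lp ℝ 2 μ) x := by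
    intro n
    rw [coe_linearCombination_sobolev]
    filter_upwards [coeFn_sum_smul (a n).support (a n) F,
      coeFn_sum_smul (a n).support (a n) (fun n => (g n : Lp ℝ 2 μ)), ae_all_iff.2 hgv]
      with x h1 h2 h3 hx
    refine h1.trans (Eq.trans ?_ h2.symm)
    refine Finset.sum_congr rfl fun i _ => ?_
    rw [h3 i, hfv i hx]
  refine ⟨g₀, ?_, ?_⟩
  -- The averages of `F` and of `g` agree on `A`, and multiplication by the indicator of `A` is
  -- continuous on `L²`, so the limits agree on `A`.
  · have hm : Measurable (A.indicator (1 : X → ℝ)) := measurable_one.indicator hA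
    have hb := abs_le_one_of_nonneg (indicator_one_nonneg A) (indicator_one_le_one A)
    have h1 := ((mulLp μ _ hm hb).continuous.tendsto _).comp hFlim
    have h2 := ((mulLp μ _ hm hb).continuous.tendsto _).comp hg₀
    have h3 : mulLp μ _ hm hb f₀ = mulLp μ _ hm hb (g₀ : Lp ℝ 2 μ) := by
      refine tendsto_nhds_unique h1 (h2.congr fun n => ?_)
      apply Lp.ext
      filter_upwards [heq n, coeFn_mulLp _ hm hb (Finsupp.linearCombination ℝ F (a n)),
        coeFn_mulLp _ hm hb ((Finsupp.linearCombination ℝ g (a n) : sobolev μ) : Lp ℝ 2 μ)]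
        with x e1 e2 e3
      refine e3.trans (Eq.trans ?_ e2.symm)
      by_cases hx : x ∈ A
      · rw [e1 hx]
      · rw [Set.indicator_of_notMem hx, zero_mul, zero_mul]
    filter_upwards [coeFn_mulLp _ hm hb f₀, coeFn_mulLp _ hm hb (g₀ : Lp ℝ 2 μ)] with x e1 e2 hx
    rw [h3, e2, Set.indicator_of_mem hx, Pi.one_apply, one_mul, one_mul] at e1
    exact e1.symm
  -- By locality `χ_A` times the averaged `θ` is `χ_A` times the differential of the averaged `g`;
  -- the two sides converge to `χ_A ω` and `χ_A dg₀`.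
  · refine tendsto_nhds_unique (((continuous_res A).tendsto ω).comp hθlim)
      ((tendsto_chiD A hslope).congr fun n => ?_)
    exact ((IsLocalDifferential.linearCombination h (a n)).res_eq hA (heq n)).symm

end Closure

end WeightedHajlasz

/-! ### The closure theorem. -/

theorem proposition3p7 {X : Type*} [MetricSpace X] [CompleteSpace X] [SecondCountableTopology X]
    [MeasurableSpace X] [BorelSpace X] (μ : Measure X) [IsFiniteOnBalls μ]
    (hX : InfinitesimallyHilbertian μ) (φ : X →ₘ[μ] ℝ) (hφ : 0 ≤ φ) (R : ℝ) (hR : 0 < R)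
    (f : ℕ → Lp ℝ 2 μ) (hf : ∀ n, f n ∈ hajlaszSobolev φ R)
    (hbdd : ∃ C : ℝ, ∀ n, hajlaszNorm φ R (f n) ≤ C)
    (f₀ : Lp ℝ 2 μ) (hlim : Tendsto f atTop (𝓝 f₀))
    (ω : CotangentL0 μ) (hd : Tendsto (fun n => differential μ (f n)) atTop (𝓝 ω)) :
    f₀ ∈ hajlaszSobolev φ R ∧ HasDifferential μ f₀ ω ∧ ω = differential μ f₀ := by
  obtain ⟨C, hC⟩ := hbdd
  -- Each `f n` is Lusin–Lipschitz, so `differential` is a genuine differential here and not its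
  -- default value 0.
  have hη : ∀ n, IsLocalDifferential μ (f n) (differential μ (f n)) := fun n => by
    obtain ⟨η, h⟩ := exists_hasDifferential hR (hf n)
    rw [h.differential_eq]
    exact h.isLocalDifferential
  obtain ⟨F, G, θ, G₀, hG, hθ, hFae, hGae, hFsum, hθsum⟩ :=
    exists_convergent_admissible hf hC hlim hη hd
  have hmem : f₀ ∈ hajlaszSobolev φ R := ⟨G₀, mem_admissible_of_tendsto hG hFae hGae⟩
  -- Pointwise convergence almost everywhere supplies the pointwise bounds that the partition
  -- requires.
  have hbound : ∀ {u : ℕ → ℝ} {l : ℝ}, Tendsto u atTop (𝓝 l) → ∃ C : ℝ, ∀ n, |u n| ≤ C :=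
    fun hu => by
      obtain ⟨C, hC⟩ := (Metric.isBounded_range_of_tendsto _ hu).exists_norm_le
      exact ⟨C, fun n => hC _ ⟨n, rfl⟩⟩
  obtain ⟨E, L, k, hE, -, hcov, hER, hL, hk⟩ := exists_lipschitz_partition hR hG (by
    filter_upwards [hFae, hGae] with x h1 h2
    exact ⟨hbound h1, hbound h2⟩)
  choose g hg hres using fun j =>
    exists_res_eq_chiD hX hR hθ hFsum hθsum (hE j) (hER j) (hL j) (hk j)
  have hloc : IsLocalDifferential μ f₀ ω := ⟨E, g, hE, hcov, hg, hres⟩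
  have hdiff := hloc.hasDifferential (exists_hasDifferential hR hmem)
  exact ⟨hmem, hdiff, hdiff.differential_eq.symm⟩
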